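/- Let $G=(V,E)$ be a directed multigraph (loops and multiple edges allowed) with countable vertex and edge sets, each edge $e$ having a tail $e^-$ and a head $e^+$. Suppose that $V$ is infinite, that $G$ is connected as an undirected graph, that every vertex has finite in-degree and finite out-degree, and that every vertex has at least one outgoing edge. The random walk on $G$ crosses at each step a uniformly chosen edge out of its current position; suppose that $G$ is transient, i.e. from every starting vertex the walk almost surely visits each vertex only finitely often. For a finite set $W\subset V$, let $G_W^*$ be the digraph obtained from $G$ by identifying all vertices of $V\setminus W$ to a single vertex $\partial_W$ and deleting all edges with both endpoints at $\partial_W$; its edges are identified with the edges of $G$ having at least one endpoint in $W$. A spanning in-arborescence of $G_W^*$ rooted at $\partial_W$ is a set of edges in which $\partial_W$ has out-degree $0$, every other vertex has out-degree $1$, and every vertex is joined to $\partial_W$ by a directed path. Let $\mathsf{UA}_{G_W^*,\partial_W}$ be the uniform distribution on these arborescences, regarded as a measure on $\{0,1\}^E$ with the product topology. *Wilson's algorithm rooted at infinity* is run with an enumeration $V=\{v_0,v_1,\dots\}$ as follows. Let $A_0$ be the empty digraph. Given $A_j$, run a random walk on $G$ from $v_j$, independent of the previous ones, stopped if and when it hits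 the vertex set of $A_j$ (it may run forever, and has length zero if $v_j\in A_j$), and let $A_{j+1}$ be the union of $A_j$ and the loop-erasure of this stopped walk. The output is $A=\bigcup_j A_j$. Here the loop-erasure of a path $\gamma$ that visits each vertex finitely often visits in order the vertices $\gamma_{t_0},\gamma_{t_1},\dots$, where $t_0=0$ and $t_{i+1}=1+\max\{t\ge t_i:\gamma_t=\gamma_{t_i}\}$, and goes from $\gamma_{t_i}$ to $\gamma_{t_{i+1}}$ along the edge that $\gamma$ crosses from time $t_{i+1}-1$ to time $t_{i+1}$. Then there is a probability measure $\mathsf{WUA}_G$ on $\{0,1\}^E$ such that: 1. for every exhaustion $V_1\subseteq V_2\subseteq\cdots$ of $V$ by finite sets with $\bigcup_n V_n=V$, the measures $\mathsf{UA}_{G_{V_n}^*,\partial_{V_n}}$ are well-defined probability measures and converge weakly to $\mathsf{WUA}_G$ as $n\to\infty$; in particular the limit exists and does not depend on the exhaustion; 2. for every enumeration of $V$, the edge set of the output of Wilson's algorithm rooted at infinity has law $\mathsf{WUA}_G$, and it is almost surely a spanning in-arboretum of $G$ rooted at infinity (every vertex has out-degree $1$, and forgetting orientations gives a forest). -/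

import Mathlib

open MeasureTheory ProbabilityTheory Filter Topology

/-- A directed multigraph with vertex set `V` and edge set `E`: each edge `e` has a tail `e⁻` and a
head `e⁺`. Loops and multiple edges are allowed. -/
structure MultiDigraph (V E : Type*) where
  tail : E → V
  head : E → V

namespace MultiDigraph

/-- The set of edges emanating from `v`. -/
def outEdges {V E : Type*} (G : MultiDigraph V E) (v : V) : Set E := {e | G.tail e = v}

/-- The set of edges pointing into `v`. -/
def inEdges {V E : Type*} (G : MultiDigraph V E) (v : V) : Set E := {e | G.head e = v}

/-- Every vertex has finite in-degree and finite out-degree. -/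
def LocallyFinite {V E : Type*} (G : MultiDigraph V E) : Prop :=
  ∀ v, (G.inEdges v).Finite ∧ (G.outEdges v).Finite

/-- Every vertex has at least one outgoing edge, so that the random walk is defined for all time. -/
def NoSinks {V E : Type*} (G : MultiDigraph V E) : Prop :=
  ∀ v, (G.outEdges v).Nonempty

/-- There is an edge of `A` from `u` to `v`. -/
def Step {V E : Type*} (G : MultiDigraph V E) (A : Set E) (u v : V) : Prop :=
  ∃ e ∈ A, G.tail e = u ∧ G.head e = v

/-- The digraph is connected as an undirected graph. -/
def Connected {V E : Type*} (G : MultiDigraph V E) : Prop :=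
  ∀ u v, Relation.EqvGen (G.Step Set.univ) u v

/-! ### Random walk -/

/-- The transition kernel of the random walk, seen as a Markov chain on edges: after the edge `e`,
the next edge is uniform on the set of edges emanating from the head of `e`. -/
noncomputable def stepKernel {V E : Type*} [MeasurableSpace E] [DiscreteMeasurableSpace E]
    (G : MultiDigraph V E) : Kernel E E where
  toFun e := uniformOn (G.outEdges (G.head e))
  measurable' := Measurable.of_discrete

theorem isMarkovKernel_stepKernel {V E : Type*} [MeasurableSpace E] [DiscreteMeasurableSpace E]
    (G : MultiDigraph V E) (hloc : G.LocallyFinite) (hout : G.NoSinks) :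
    IsMarkovKernel G.stepKernel :=
  ⟨fun e => isProbabilityMeasure_uniformOn (hloc (G.head e)).2 (hout (G.head e))⟩

/-- The step kernel as a function of the trajectory `e₀, …, eₙ` (it only looks at `eₙ`). -/
noncomputable def historyKernel {V E : Type*} [MeasurableSpace E] [DiscreteMeasurableSpace E]
    (G : MultiDigraph V E) (n : ℕ) : Kernel (Finset.Iic n → E) E :=
  G.stepKernel.comap (fun h => h ⟨n, Finset.mem_Iic.2 le_rfl⟩) (measurable_pi_apply _)

theorem isMarkovKernel_historyKernel {V E : Type*} [MeasurableSpace E]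
    [DiscreteMeasurableSpace E] (G : MultiDigraph V E) (hloc : G.LocallyFinite)
    (hout : G.NoSinks) (n : ℕ) : IsMarkovKernel (G.historyKernel n) := by
  have := G.isMarkovKernel_stepKernel hloc hout
  unfold historyKernel
  infer_instance

/-- The law `𝐏ₓ` of the random walk started at `x`, as a measure on the sequences `e₀, e₁, …` of
crossed edges: `e₀` is uniform on the edges emanating from `x`, and then each edge is uniform on the
edges emanating from the head of the previous one. -/
noncomputable def walkLaw {V E : Type*} [MeasurableSpace E] [DiscreteMeasurableSpace E]
    (G : MultiDigraph V E) (hloc : G.LocallyFinite) (hout : G.NoSinks) (x : V) :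
    Measure (ℕ → E) :=
  haveI := G.isMarkovKernel_historyKernel hloc hout
  Kernel.trajMeasure (X := fun _ : ℕ => E) (uniformOn (G.outEdges x)) G.historyKernel

theorem isProbabilityMeasure_walkLaw {V E : Type*} [MeasurableSpace E]
    [DiscreteMeasurableSpace E] (G : MultiDigraph V E) (hloc : G.LocallyFinite)
    (hout : G.NoSinks) (x : V) : IsProbabilityMeasure (G.walkLaw hloc hout x) := by
  have := G.isMarkovKernel_historyKernel hloc hout
  have : IsProbabilityMeasure (uniformOn (G.outEdges x)) :=
    isProbabilityMeasure_uniformOn (hloc x).2 (hout x)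
  unfold walkLaw
  infer_instance

/-- The vertex visited at time `t` by the path that starts at `x` and crosses the edges
`e₀, e₁, …`. -/
def vertexAt {V E : Type*} (G : MultiDigraph V E) (x : V) (e : ℕ → E) : ℕ → V
  | 0 => x
  | t + 1 => G.head (e t)

/-- The random walk from any starting vertex visits each vertex finitely often almost surely. -/
def Transient {V E : Type*} [MeasurableSpace E] [DiscreteMeasurableSpace E]
    (G : MultiDigraph V E) (hloc : G.LocallyFinite) (hout : G.NoSinks) : Prop :=
  ∀ x, ∀ᵐ e ∂(G.walkLaw hloc hout x), ∀ v, {t : ℕ | G.vertexAt x e t = v}.Finite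

/-! ### Arborescences and the wired finite digraphs -/

/-- The edge set `A` is that of a spanning in-arborescence rooted at `r`: every vertex other than
`r` has out-degree one, `r` has out-degree zero, and every vertex is connected to `r` by a directed
path in `A`. -/
structure IsSpanningInArborescence {V E : Type*} (G : MultiDigraph V E) (r : V) (A : Set E) :
    Prop where
  existsUnique_out : ∀ v, v ≠ r → ∃! e, e ∈ A ∧ G.tail e = v
  root_out : ∀ e ∈ A, G.tail e ≠ r
  path_to_root : ∀ v, Relation.ReflTransGen (G.Step A) v r

/-- The edge set `A` is that of a spanning in-arboretum rooted at infinity: every vertex has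
out-degree one, and forgetting orientations yields a forest. Since all out-degrees are one, every
cycle of the unoriented graph is a directed cycle, so only directed cycles have to be excluded. -/
structure IsSpanningInArboretum {V E : Type*} (G : MultiDigraph V E) (A : Set E) : Prop where
  existsUnique_out : ∀ v, ∃! e, e ∈ A ∧ G.tail e = v
  acyclic : ∀ v, ¬ Relation.TransGen (G.Step A) v v

/-- An exhaustion: an increasing sequence of finite vertex sets with union `V`. -/
structure IsExhaustion {V : Type*} (W : ℕ → Finset V) : Prop where
  monotone : Monotone W
  exists_mem : ∀ v, ∃ n, v ∈ W n

open Classical in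
/-- The image of `v` when all the vertices outside `W` are identified to the single boundary vertex
`∂ = none`. -/
noncomputable def collapse {V : Type*} (W : Finset V) (v : V) : Option W :=
  if h : v ∈ W then some ⟨v, h⟩ else none

/-- The wired digraph `G_W^*`: all vertices outside `W` are identified to a single vertex `none`, and
the edges with both endpoints at this vertex are deleted. -/
noncomputable def wired {V E : Type*} (G : MultiDigraph V E) (W : Finset V) :
    MultiDigraph (Option W) {e : E // G.tail e ∈ W ∨ G.head e ∈ W} where
  tail e := collapse W (G.tail e)
  head e := collapse W (G.head e)

open Classical in
/-- The indicator function of a set of edges, a point of the compact space `{0,1}^E`. -/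
noncomputable def config {E : Type*} (A : Set E) : E → Bool := fun e => decide (e ∈ A)

/-- The law of the uniform spanning in-arborescence of `G_W^*` rooted at the boundary vertex, as a
measure on subsets of `E` (the edges of `G_W^*` being edges of `G`). -/
noncomputable def wiredUA {V E : Type*} (G : MultiDigraph V E) (W : Finset V) :
    Measure (E → Bool) :=
  uniformOn ((fun T : Set {e : E // G.tail e ∈ W ∨ G.head e ∈ W} =>
    config (Subtype.val '' T)) '' {T | (G.wired W).IsSpanningInArborescence none T})

/-! ### Loop erasure -/

/-- `t` is the last time, among the times `≤ N`, at which the sequence `γ` is at `γ s`. -/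
def IsLastVisit {V : Type*} (γ : ℕ → V) (N : ℕ∞) (s t : ℕ) : Prop :=
  IsGreatest {r : ℕ | s ≤ r ∧ (r : ℕ∞) ≤ N ∧ γ r = γ s} t

/-- The times `t₀ = 0`, `tᵢ₊₁ = 1 + max {t ≥ tᵢ : γ t = γ tᵢ}` at which the loop-erasure of the path
`γ` of length `N` (finite or infinite) picks up its vertices. -/
inductive IsLoopErasureTime {V : Type*} (γ : ℕ → V) (N : ℕ∞) : ℕ → Prop
  | zero : IsLoopErasureTime γ N 0
  | next {s t : ℕ} : IsLoopErasureTime γ N s → IsLastVisit γ N s t → (t : ℕ∞) < N →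
      IsLoopErasureTime γ N (t + 1)

/-- The vertices `γ tᵢ` of the loop-erasure of the path of length `N` from `x` with edges `e`. -/
def loopErasureVertices {V E : Type*} (G : MultiDigraph V E) (x : V) (e : ℕ → E) (N : ℕ∞) :
    Set V :=
  {v | ∃ s, IsLoopErasureTime (G.vertexAt x e) N s ∧ G.vertexAt x e s = v}

/-- The edges of the loop-erasure of the path of length `N` from `x` with edges `e`: the edge from
`γ tᵢ` to `γ tᵢ₊₁` is the one that the path crosses when it leaves `γ tᵢ` for the last time. -/
def loopErasureEdges {V E : Type*} (G : MultiDigraph V E) (x : V) (e : ℕ → E) (N : ℕ∞) :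
    Set E :=
  {a | ∃ s t, IsLoopErasureTime (G.vertexAt x e) N s ∧ IsLastVisit (G.vertexAt x e) N s t ∧
    (t : ℕ∞) < N ∧ e t = a}

/-! ### Wilson's algorithm rooted at infinity -/

/-- The first time that the path hits the vertex set `W` (`⊤` if it never does). -/
noncomputable def hitTime {V E : Type*} (G : MultiDigraph V E) (x : V) (e : ℕ → E) (W : Set V) :
    ℕ∞ :=
  ⨅ t ∈ {t : ℕ | G.vertexAt x e t ∈ W}, (t : ℕ∞)

/-- The pair (vertex set, edge set) of `A_j` in Wilson's algorithm rooted at infinity, run with the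
enumeration `v₀, v₁, …` of the vertices, where `X j` is the sequence of edges crossed by the walk
started at `v j`: the walk is stopped if and when it hits `A_j`, and its loop-erasure is added. -/
noncomputable def wilsonStage {V E : Type*} (G : MultiDigraph V E) (v : ℕ → V)
    (X : ℕ → ℕ → E) : ℕ → Set V × Set E
  | 0 => (∅, ∅)
  | j + 1 =>
    let A := wilsonStage G v X j
    let N := G.hitTime (v j) (X j) A.1
    (A.1 ∪ G.loopErasureVertices (v j) (X j) N, A.2 ∪ G.loopErasureEdges (v j) (X j) N)

/-- The edge set of the output `A = ⋃ⱼ A_j` of Wilson's algorithm rooted at infinity. -/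
noncomputable def wilsonOutput {V E : Type*} (G : MultiDigraph V E) (v : ℕ → V)
    (X : ℕ → ℕ → E) : Set E :=
  ⋃ j, (G.wilsonStage v X j).2

/-- The joint law of independent random walks started at `v₀, v₁, …`. -/
noncomputable def walksLaw {V E : Type*} [MeasurableSpace E] [DiscreteMeasurableSpace E]
    (G : MultiDigraph V E) (hloc : G.LocallyFinite) (hout : G.NoSinks) (v : ℕ → V) :
    Measure (ℕ → ℕ → E) :=
  haveI := fun j => G.isProbabilityMeasure_walkLaw hloc hout (v j)
  Measure.infinitePi (fun j => G.walkLaw hloc hout (v j))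

end MultiDigraph

/-!
Weak convergence of the wired measures and the description of the limit both come from running
Wilson's algorithm on all the wired digraphs `G_W^*` and on `G` with the same family of independent
walks. Wilson's algorithm on `G_W^*` is the algorithm rooted at infinity started from the vertex set
`Wᶜ` in place of `∅` (`stageFrom`, `outputFrom`).

*Finite digraphs.* For a finite set `W`, the output is almost surely an arborescence
(`isWiredArborescence_outputFrom`), so it suffices that all arborescences `T` have the same
probability (`walksLaw_outputFrom_eq`). Let `S` be the set of vertices not yet reached. If the
loop-erasure of the next walk, started at `x` and stopped outside `S`, is to follow `T`, then after
its last visit to `x` the walk has to cross the edge of `T` out of `x` and, from there on, to follow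
`T` in `S \ {x}`. As a function of the starting point `y` of the walk, the probability `h y` of this
last-exit event solves `(1 - P) h = c δ_x` on `S`, where `c` is `1 / deg x` times the corresponding
probability for `S \ {x}`. By Cramer's rule `det (1 - P)_S * h x = c * det (1 - P)_{S \ {x}}`
(`det_mul_walkLaw_lastExitEvent`). Iterating along a walk
(`exists_det_mul_walkLaw_loopErasureEvent`) and over the independent walks
(`det_mul_walksLaw_stageFrom`), the determinants telescope and leave
`det (1 - P)_W * P(output = T) = ∏_{u ∈ W} 1 / deg u`, which does not depend on `T`. This gives
`map_config_outputFrom`.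

*The limit.* Along fixed transient paths, if every vertex lies in only finitely many of the sets
`Bₙ`, then the stages of the algorithm started from `Bₙ` converge edge by edge to those of the
algorithm rooted at infinity: a walk that hits the current set does so within finitely many steps, and the loop-erasure
of a transient path is the local limit of the loop-erasures of its initial pieces
(`eventually_mem_outputFrom`). Hence `config` of the outputs converges almost surely, which implies
convergence of the laws (`tendsto_wiredUA`), and the limit inherits unique out-edges and acyclicity
from the arborescences (`isSpanningInArboretum_of_eventually`). Uniqueness of weak limits makes the
law independent of the exhaustion and of the enumeration.
-/

namespace MultiDigraph

/-! ### The law of the random walk -/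

section WalkLaw

variable {V E : Type*}

/-- The trajectory that crosses `a` first and then follows `e`. -/
def cons (a : E) (e : ℕ → E) : ℕ → E
  | 0 => a
  | n + 1 => e n

@[simp] lemma cons_zero (a : E) (e : ℕ → E) : cons a e 0 = a := rfl

@[simp] lemma cons_succ (a : E) (e : ℕ → E) (n : ℕ) : cons a e (n + 1) = e n := rfl

lemma vertexAt_cons_succ (G : MultiDigraph V E) (x : V) (a : E) (e : ℕ → E) (t : ℕ) :
    G.vertexAt x (cons a e) (t + 1) = G.vertexAt (G.head a) e t := by
  cases t <;> rfl

variable [MeasurableSpace E]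

lemma measurable_cons (a : E) : Measurable (cons a) := by
  refine measurable_pi_lambda _ fun n => ?_
  cases n with
  | zero => exact measurable_const
  | succ n => exact measurable_pi_apply n

variable [DiscreteMeasurableSpace E] (G : MultiDigraph V E) (hloc : G.LocallyFinite)
  (hout : G.NoSinks)

lemma map_eval_zero_walkLaw (x : V) :
    (G.walkLaw hloc hout x).map (fun e => e 0) = uniformOn (G.outEdges x) := by
  have := G.isMarkovKernel_historyKernel hloc hout
  have h1 : (fun e : ℕ → E => e 0) =
      (MeasurableEquiv.piUnique (fun _ : Finset.Iic 0 => E)) ∘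
        (Preorder.frestrictLe (π := fun _ : ℕ => E) 0) := by
    funext e; rfl
  rw [h1, ← Measure.map_map (by fun_prop) (by fun_prop)]
  unfold walkLaw
  rw [Kernel.trajMeasure, Measure.map_comp _ _ (by fun_prop), Kernel.traj_map_frestrictLe,
    Kernel.partialTraj_self, Measure.id_comp, Measure.map_map (by fun_prop) (by fun_prop)]
  exact Measure.map_id

variable [Countable E]

/-- The probability that the walk starts with the first `n + 1` edges of a given trajectory. -/
lemma walkLaw_cylinder (x : V) (w : ℕ → E) (n : ℕ) :
    G.walkLaw hloc hout x {e | ∀ i ≤ n, e i = w i} =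
      ∏ i ∈ Finset.range (n + 1), uniformOn (G.outEdges (G.vertexAt x w i)) {w i} := by
  have := G.isMarkovKernel_historyKernel hloc hout
  have : IsProbabilityMeasure (uniformOn (G.outEdges x)) :=
    isProbabilityMeasure_uniformOn (hloc x).2 (hout x)
  induction n with
  | zero =>
    have : {e : ℕ → E | ∀ i ≤ 0, e i = w i} = (fun e : ℕ → E => e 0) ⁻¹' {w 0} := by
      ext e; simp
    rw [this, ← Measure.map_apply (measurable_pi_apply 0) (measurableSet_singleton _),
      map_eval_zero_walkLaw]
    simp [vertexAt]
  | succ n ih =>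
    have key := Kernel.map_frestrictLe_trajMeasure_compProd_eq_map_trajMeasure
      (X := fun _ : ℕ => E) (μ₀ := uniformOn (G.outEdges x)) (κ := G.historyKernel) (a := n)
    have hset : {e : ℕ → E | ∀ i ≤ n + 1, e i = w i} =
        (fun e : ℕ → E => (Preorder.frestrictLe (π := fun _ : ℕ => E) n e, e (n + 1))) ⁻¹'
          ({Preorder.frestrictLe (π := fun _ : ℕ => E) n w} ×ˢ {w (n + 1)}) := by
      ext e
      simp only [Set.mem_ofPred_eq, Set.mem_preimage, Set.mem_prod, Set.mem_singleton_iff,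
        funext_iff, Subtype.forall, Finset.mem_Iic, Preorder.frestrictLe_apply]
      constructor
      · exact fun h => ⟨fun i hi => h i (by omega), h _ le_rfl⟩
      · rintro ⟨h1, h2⟩ i hi
        rcases Nat.lt_or_ge n i with h | h
        · obtain rfl : i = n + 1 := by omega
          exact h2
        · exact h1 i h
    have hset' : {e : ℕ → E | ∀ i ≤ n, e i = w i} =
        Preorder.frestrictLe (π := fun _ : ℕ => E) n ⁻¹'
          {Preorder.frestrictLe (π := fun _ : ℕ => E) n w} := by
      ext e
      simp only [Set.mem_ofPred_eq, Set.mem_preimage, Set.mem_singleton_iff,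
        funext_iff, Subtype.forall, Finset.mem_Iic, Preorder.frestrictLe_apply]
    rw [Finset.prod_range_succ, ← ih, hset, hset']
    change Kernel.trajMeasure _ _ _ = Kernel.trajMeasure _ _ _ * _
    rw [← Measure.map_apply (by fun_prop) ((measurableSet_singleton _).prod
      (measurableSet_singleton _)), ← key, Measure.compProd_apply_prod (measurableSet_singleton _)
      (measurableSet_singleton _), lintegral_singleton,
      Measure.map_apply (by fun_prop) (measurableSet_singleton _), mul_comm]
    rfl

/-- Two finite measures on trajectories agree if they agree on the events that prescribe finitely
many initial edges. -/
lemma measure_ext_cylinder {μ ν : Measure (ℕ → E)} [IsFiniteMeasure μ] [IsFiniteMeasure ν]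
    (h : ∀ (w : ℕ → E) (n : ℕ), μ {e | ∀ i ≤ n, e i = w i} = ν {e | ∀ i ≤ n, e i = w i}) :
    μ = ν := by
  have hn : ∀ n, μ.map (Preorder.frestrictLe (π := fun _ : ℕ => E) n) =
      ν.map (Preorder.frestrictLe (π := fun _ : ℕ => E) n) := by
    intro n
    refine Measure.ext_of_singleton fun g => ?_
    rw [Measure.map_apply (by fun_prop) (measurableSet_singleton _),
      Measure.map_apply (by fun_prop) (measurableSet_singleton _)]
    have hset : Preorder.frestrictLe (π := fun _ : ℕ => E) n ⁻¹' {g} =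
        {e | ∀ i ≤ n, e i = (fun j => if hj : j ≤ n then g ⟨j, Finset.mem_Iic.2 hj⟩
          else g ⟨n, Finset.mem_Iic.2 le_rfl⟩) i} := by
      ext e
      simp only [Set.mem_ofPred_eq, Set.mem_preimage, Set.mem_singleton_iff,
        funext_iff, Subtype.forall, Finset.mem_Iic, Preorder.frestrictLe_apply]
      refine forall_congr' fun i => forall_congr' fun hi => ?_
      simp [hi]
    rw [hset]
    exact h _ n
  refine IsProjectiveLimit.unique
    (P := fun I : Finset ℕ => ν.map (I.restrict (π := fun _ : ℕ => E))) ?_ fun I => rfl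
  intro I
  have hI : I ⊆ Finset.Iic (I.sup id) := fun i hi =>
    Finset.mem_Iic.2 (Finset.le_sup (f := id) hi)
  have hr : I.restrict (π := fun _ : ℕ => E) = Finset.restrict₂ (π := fun _ : ℕ => E) hI ∘
      Preorder.frestrictLe (π := fun _ : ℕ => E) (I.sup id) := rfl
  rw [hr, ← Measure.map_map (by fun_prop) (by fun_prop), hn,
    Measure.map_map (by fun_prop) (by fun_prop)]
  rfl

/-- First-step decomposition (the Markov property at time one). -/
lemma walkLaw_firstStep (x : V) {B : Set (ℕ → E)} (hB : MeasurableSet B) :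
    G.walkLaw hloc hout x B =
      ∑' a, uniformOn (G.outEdges x) {a} * G.walkLaw hloc hout (G.head a) (cons a ⁻¹' B) := by
  have := G.isProbabilityMeasure_walkLaw hloc hout
  have : ∀ x, IsProbabilityMeasure (uniformOn (G.outEdges x)) := fun x =>
    isProbabilityMeasure_uniformOn (hloc x).2 (hout x)
  set κ : E → Measure (ℕ → E) := fun a => (G.walkLaw hloc hout (G.head a)).map (cons a) with hκ
  have hκm : Measurable κ := Measurable.of_discrete
  have hκp : ∀ a, IsProbabilityMeasure (κ a) := fun a =>
    Measure.isProbabilityMeasure_map (measurable_cons a).aemeasurable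
  have hbind : ∀ C, MeasurableSet C → ((uniformOn (G.outEdges x)).bind κ) C =
      ∑' a, uniformOn (G.outEdges x) {a} * G.walkLaw hloc hout (G.head a) (cons a ⁻¹' C) := by
    intro C hC
    rw [Measure.bind_apply hC hκm.aemeasurable, lintegral_countable']
    refine tsum_congr fun a => ?_
    rw [mul_comm, hκ, Measure.map_apply (measurable_cons a) hC]
  rw [← hbind B hB]
  congr 1
  have : IsFiniteMeasure ((uniformOn (G.outEdges x)).bind κ) := by
    refine ⟨?_⟩
    rw [Measure.bind_apply MeasurableSet.univ hκm.aemeasurable]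
    simp
  refine measure_ext_cylinder fun w n => ?_
  have hms : MeasurableSet {e : ℕ → E | ∀ i ≤ n, e i = w i} := by
    simp only [Set.ofPred_forall]
    exact MeasurableSet.iInter fun i => MeasurableSet.iInter fun _ =>
      measurableSet_eq_fun (measurable_pi_apply i) measurable_const
  rw [hbind _ hms, tsum_eq_single (w 0), walkLaw_cylinder, Finset.prod_range_succ']
  · rw [mul_comm]
    congr 1
    cases n with
    | zero =>
      have : (cons (w 0) ⁻¹' {e : ℕ → E | ∀ i ≤ 0, e i = w i}) = Set.univ := by
        ext e; simp
      rw [this]; simp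
    | succ n =>
      have : (cons (w 0) ⁻¹' {e : ℕ → E | ∀ i ≤ n + 1, e i = w i}) =
          {e | ∀ i ≤ n, e i = (fun j => w (j + 1)) i} := by
        ext e
        simp only [Set.mem_preimage, Set.mem_ofPred_eq]
        constructor
        · exact fun h i hi => h (i + 1) (by omega)
        · rintro h (_ | i) hi
          · rfl
          · exact h i (by omega)
      rw [this, walkLaw_cylinder]
      refine Finset.prod_congr rfl fun i _ => ?_
      cases i <;> rfl
  · intro a ha
    have : (cons a ⁻¹' {e : ℕ → E | ∀ i ≤ n, e i = w i}) = ∅ := by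
      ext e
      simp only [Set.mem_preimage, Set.mem_ofPred_eq, Set.mem_empty_iff_false, iff_false]
      exact fun h => ha (h 0 (Nat.zero_le _))
    rw [this, measure_empty, mul_zero]

/-- The edge sequence `e` is a directed path from `x`. -/
def IsPath {V E : Type*} (G : MultiDigraph V E) (x : V) (e : ℕ → E) : Prop :=
  ∀ t, G.tail (e t) = G.vertexAt x e t

lemma ae_isPath (x : V) : ∀ᵐ e ∂(G.walkLaw hloc hout x), G.IsPath x e := by
  have hms : ∀ (u : V) t, MeasurableSet {e : ℕ → E | G.tail (e t) = G.vertexAt u e t} := by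
    intro u t
    cases t with
    | zero =>
      exact (measurable_pi_apply (X := fun _ : ℕ => E) 0)
        (MeasurableSet.of_discrete (s := {a | G.tail a = u}))
    | succ t =>
      exact ((measurable_pi_apply (X := fun _ : ℕ => E) (t + 1)).prodMk (measurable_pi_apply t))
        (MeasurableSet.of_discrete (s := {a : E × E | G.tail a.1 = G.head a.2}))
  refine ae_all_iff.2 fun t => ?_
  induction t generalizing x with
  | zero =>
    rw [ae_iff, ← Set.compl_ofPred, walkLaw_firstStep _ _ _ _ (hms x 0).compl, ENNReal.tsum_eq_zero]
    intro a
    by_cases ha : G.tail a = x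
    · have : (cons a ⁻¹' {e : ℕ → E | G.tail (e 0) = G.vertexAt x e 0}ᶜ) = ∅ := by
        ext e; simp [vertexAt, ha]
      rw [this, measure_empty, mul_zero]
    · have : uniformOn (G.outEdges x) {a} = 0 := by
        rw [uniformOn_eq_zero_iff (hloc x).2]
        ext b
        simp only [outEdges, Set.mem_inter_iff, Set.mem_ofPred_eq, Set.mem_singleton_iff,
          Set.mem_empty_iff_false, iff_false]
        rintro ⟨h1, rfl⟩
        exact ha h1
      rw [this, zero_mul]
  | succ t ih =>
    rw [ae_iff, ← Set.compl_ofPred, walkLaw_firstStep _ _ _ _ (hms x (t + 1)).compl,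
      ENNReal.tsum_eq_zero]
    intro a
    have := ih (G.head a)
    rw [ae_iff] at this
    have h2 : (cons a ⁻¹' {e : ℕ → E | G.tail (e (t + 1)) = G.vertexAt x e (t + 1)}ᶜ) =
        {e | ¬ G.tail (e t) = G.vertexAt (G.head a) e t} := by
      ext e
      simp [vertexAt_cons_succ]
    rw [h2, this, mul_zero]

end WalkLaw

/-! ### Loop erasure of a fixed path -/

section LoopErasure

variable {V E : Type*}

lemma IsLastVisit.le {γ : ℕ → V} {N : ℕ∞} {s t : ℕ} (h : IsLastVisit γ N s t) : s ≤ t := h.1.1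

lemma IsLastVisit.le_length {γ : ℕ → V} {N : ℕ∞} {s t : ℕ} (h : IsLastVisit γ N s t) :
    (t : ℕ∞) ≤ N := h.1.2.1

lemma IsLastVisit.eq {γ : ℕ → V} {N : ℕ∞} {s t : ℕ} (h : IsLastVisit γ N s t) : γ t = γ s :=
  h.1.2.2

lemma IsLastVisit.time_le {γ : ℕ → V} {N : ℕ∞} {s t r : ℕ} (h : IsLastVisit γ N s t)
    (hr : (r : ℕ∞) ≤ N) (hγ : γ r = γ s) : r ≤ t := by
  by_contra! hlt
  exact absurd (h.2 ⟨h.le.trans hlt.le, hr, hγ⟩) (not_le.2 hlt)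

lemma IsLastVisit.unique {γ : ℕ → V} {N : ℕ∞} {s t s' t' : ℕ} (h : IsLastVisit γ N s t)
    (h' : IsLastVisit γ N s' t') (hγ : γ s = γ s') : t = t' :=
  le_antisymm (h'.time_le h.le_length (h.eq.trans hγ))
    (h.time_le h'.le_length (h'.eq.trans hγ.symm))

lemma exists_isLastVisit {γ : ℕ → V} {N : ℕ∞} {s : ℕ} (hs : (s : ℕ∞) ≤ N)
    (hb : N ≠ ⊤ ∨ {r | γ r = γ s}.Finite) : ∃ t, IsLastVisit γ N s t := by
  have hbdd : BddAbove {r : ℕ | s ≤ r ∧ (r : ℕ∞) ≤ N ∧ γ r = γ s} := by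
    rcases hb with hN | hfin
    · lift N to ℕ using hN
      exact ⟨N, fun r hr => by exact_mod_cast hr.2.1⟩
    · exact (hfin.subset fun r hr => hr.2.2).bddAbove
  exact ⟨sSup _, Nat.sSup_mem ⟨s, le_rfl, hs, rfl⟩ hbdd, fun r hr => le_csSup hbdd hr⟩

lemma IsLoopErasureTime.le_length {γ : ℕ → V} {N : ℕ∞} {s : ℕ} (h : IsLoopErasureTime γ N s) :
    (s : ℕ∞) ≤ N := by
  cases h with
  | zero => exact bot_le
  | next _ _ hlt => exact_mod_cast Order.add_one_le_of_lt hlt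

variable (G : MultiDigraph V E) {x : V} {e : ℕ → E} {N : ℕ∞}

lemma start_mem_loopErasureVertices : x ∈ G.loopErasureVertices x e N :=
  ⟨0, .zero, rfl⟩

lemma exists_mem_loopErasureVertices_time {u : V} (hu : u ∈ G.loopErasureVertices x e N) :
    ∃ s : ℕ, (s : ℕ∞) ≤ N ∧ G.vertexAt x e s = u := by
  obtain ⟨s, hs, rfl⟩ := hu
  exact ⟨s, hs.le_length, rfl⟩

lemma tail_mem_loopErasureVertices (hp : G.IsPath x e) {a : E}
    (ha : a ∈ G.loopErasureEdges x e N) : G.tail a ∈ G.loopErasureVertices x e N := by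
  obtain ⟨s, t, hs, ht, hlt, rfl⟩ := ha
  exact ⟨s, hs, by rw [hp t, ht.eq]⟩

/-- The tail of an edge of the loop-erasure is visited strictly before the end of the path. -/
lemma exists_lt_tail_eq (hp : G.IsPath x e) {a : E} (ha : a ∈ G.loopErasureEdges x e N) :
    ∃ t : ℕ, (t : ℕ∞) < N ∧ G.vertexAt x e t = G.tail a := by
  obtain ⟨s, t, hs, ht, hlt, rfl⟩ := ha
  exact ⟨t, hlt, (hp t).symm⟩

/-- The loop-erasure has at most one edge out of each vertex: the one crossed at the last visit. -/
lemma loopErasureEdges_unique (hp : G.IsPath x e) {a b : E} (ha : a ∈ G.loopErasureEdges x e N)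
    (hb : b ∈ G.loopErasureEdges x e N) (hab : G.tail a = G.tail b) : a = b := by
  obtain ⟨s, t, hs, ht, hlt, rfl⟩ := ha
  obtain ⟨s', t', hs', ht', hlt', rfl⟩ := hb
  rw [hp t, hp t', ht.eq, ht'.eq] at hab
  rw [ht.unique ht' hab]

/-- Every vertex of the loop-erasure of a finite path, except for the endpoint of the path, has an
edge of the loop-erasure going out of it. -/
lemma exists_loopErasureEdge {n : ℕ} (hp : G.IsPath x e) {u : V}
    (hu : u ∈ G.loopErasureVertices x e n) (hne : u ≠ G.vertexAt x e n) :
    ∃ a ∈ G.loopErasureEdges x e n, G.tail a = u := by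
  obtain ⟨s, hs, rfl⟩ := hu
  obtain ⟨t, ht⟩ := exists_isLastVisit (γ := G.vertexAt x e) hs.le_length
      (.inl (ENat.natCast_ne_top n))
  have hlt : (t : ℕ∞) < (n : ℕ∞) := by
    refine lt_of_le_of_ne ht.le_length fun h => hne ?_
    rw [← ht.eq, Nat.cast_injective h]
  exact ⟨e t, ⟨s, t, hs, ht, hlt, rfl⟩, by rw [hp t, ht.eq]⟩

lemma loopErasureVertices_reaches_end {n : ℕ} (hp : G.IsPath x e) {u : V}
    (hu : u ∈ G.loopErasureVertices x e n) :
    Relation.ReflTransGen (G.Step (G.loopErasureEdges x e n)) u (G.vertexAt x e n) := by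
  obtain ⟨s, hs, rfl⟩ := hu
  induction hk : n - s using Nat.strong_induction_on generalizing s with
  | _ k ih =>
    obtain ⟨t, ht⟩ := exists_isLastVisit (γ := G.vertexAt x e) hs.le_length
      (.inl (ENat.natCast_ne_top n))
    have htn : t ≤ n := by exact_mod_cast ht.le_length
    rcases htn.eq_or_lt with rfl | hlt
    · rw [ht.eq]
    · have hlt' : (t : ℕ∞) < (n : ℕ∞) := by exact_mod_cast hlt
      have hst := ht.le
      exact .head ⟨e t, ⟨s, t, hs, ht, hlt', rfl⟩, by rw [hp t, ht.eq], rfl⟩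
        (ih (n - (t + 1)) (by omega) (t + 1) (hs.next ht hlt') rfl)

/-! ### Decomposition at the last visit to the starting point -/

lemma vertexAt_shift (x : V) (e : ℕ → E) (k t : ℕ) :
    G.vertexAt (G.head (e k)) (fun i => e (i + (k + 1))) t = G.vertexAt x e (t + (k + 1)) := by
  cases t with
  | zero => simp [vertexAt]
  | succ t => rw [Nat.add_right_comm t 1]; rfl

lemma isLastVisit_shift {γ : ℕ → V} {k m s t : ℕ} :
    IsLastVisit γ ((m + k : ℕ) : ℕ∞) (s + k) (t + k) ↔
      IsLastVisit (fun i => γ (i + k)) (m : ℕ∞) s t := by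
  constructor
  · rintro ⟨⟨h1, h2, h3⟩, h4⟩
    refine ⟨⟨by omega, ?_, h3⟩, ?_⟩
    · have : t + k ≤ m + k := by exact_mod_cast h2
      exact_mod_cast (by omega : t ≤ m)
    · rintro r ⟨hr1, hr2, hr3⟩
      have hr2' : r ≤ m := by exact_mod_cast hr2
      have := @h4 (r + k) ⟨by omega, by exact_mod_cast (by omega : r + k ≤ m + k), hr3⟩
      omega
  · rintro ⟨⟨h1, h2, h3⟩, h4⟩
    have h2' : t ≤ m := by exact_mod_cast h2
    refine ⟨⟨by omega, by exact_mod_cast (by omega : t + k ≤ m + k), h3⟩, ?_⟩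
    rintro r ⟨hr1, hr2, hr3⟩
    have hr2' : r ≤ m + k := by exact_mod_cast hr2
    obtain ⟨r, rfl⟩ : ∃ r', r = r' + k := ⟨r - k, by omega⟩
    have := @h4 r ⟨by omega, by exact_mod_cast (by omega : r ≤ m), hr3⟩
    omega

/-- The times picked up by the loop-erasure of a path of length `m + (k + 1)` whose last visit to
its starting point is at time `k`. -/
lemma isLoopErasureTime_shift {γ : ℕ → V} {k m : ℕ}
    (hk : IsLastVisit γ ((m + (k + 1) : ℕ) : ℕ∞) 0 k) (s : ℕ) :
    IsLoopErasureTime γ ((m + (k + 1) : ℕ) : ℕ∞) s ↔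
      s = 0 ∨ ∃ s', s = s' + (k + 1) ∧
        IsLoopErasureTime (fun i => γ (i + (k + 1))) (m : ℕ∞) s' := by
  have hkm : (k : ℕ∞) < ((m + (k + 1) : ℕ) : ℕ∞) := by exact_mod_cast (by omega)
  constructor
  · intro h
    induction h with
    | zero => exact .inl rfl
    | @next s t hs ht hlt ih =>
      right
      rcases ih with rfl | ⟨s', rfl, hs'⟩
      · exact ⟨0, by rw [ht.unique hk rfl]; omega, .zero⟩
      · obtain ⟨t, rfl⟩ : ∃ t', t = t' + (k + 1) := ⟨t - (k + 1), by have := ht.le; omega⟩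
        refine ⟨t + 1, by omega, hs'.next (isLastVisit_shift.1 ht) ?_⟩
        have : t + (k + 1) < m + (k + 1) := by exact_mod_cast hlt
        exact_mod_cast (by omega : t < m)
  · rintro (rfl | ⟨s', rfl, hs'⟩)
    · exact .zero
    · induction hs' with
      | zero => simpa using IsLoopErasureTime.zero.next hk hkm
      | @next s t hs ht hlt ih =>
        have hlt' : t < m := by exact_mod_cast hlt
        have := ih.next (isLastVisit_shift.2 ht)
          (by exact_mod_cast (by omega : t + (k + 1) < m + (k + 1)))
        rwa [show t + 1 + (k + 1) = t + (k + 1) + 1 by omega]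

lemma loopErasureVertices_eq_insert {k m : ℕ}
    (hk : IsLastVisit (G.vertexAt x e) ((m + (k + 1) : ℕ) : ℕ∞) 0 k) :
    G.loopErasureVertices x e ((m + (k + 1) : ℕ) : ℕ∞) =
      insert x (G.loopErasureVertices (G.head (e k)) (fun i => e (i + (k + 1))) (m : ℕ∞)) := by
  have hγ : G.vertexAt (G.head (e k)) (fun i => e (i + (k + 1))) =
      fun i => G.vertexAt x e (i + (k + 1)) := funext fun t => G.vertexAt_shift x e k t
  ext u
  simp only [loopErasureVertices, Set.mem_ofPred_eq, Set.mem_insert_iff, hγ,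
    isLoopErasureTime_shift hk]
  constructor
  · rintro ⟨s, rfl | ⟨s', rfl, hs'⟩, rfl⟩
    · exact .inl rfl
    · exact .inr ⟨s', hs', rfl⟩
  · rintro (rfl | ⟨s', hs', rfl⟩)
    · exact ⟨0, .inl rfl, rfl⟩
    · exact ⟨_, .inr ⟨s', rfl, hs'⟩, rfl⟩

lemma loopErasureEdges_eq_insert {k m : ℕ}
    (hk : IsLastVisit (G.vertexAt x e) ((m + (k + 1) : ℕ) : ℕ∞) 0 k) :
    G.loopErasureEdges x e ((m + (k + 1) : ℕ) : ℕ∞) =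
      insert (e k)
        (G.loopErasureEdges (G.head (e k)) (fun i => e (i + (k + 1))) (m : ℕ∞)) := by
  have hγ : G.vertexAt (G.head (e k)) (fun i => e (i + (k + 1))) =
      fun i => G.vertexAt x e (i + (k + 1)) := funext fun t => G.vertexAt_shift x e k t
  ext a
  simp only [loopErasureEdges, Set.mem_ofPred_eq, Set.mem_insert_iff, hγ,
    isLoopErasureTime_shift hk]
  constructor
  · rintro ⟨s, t, rfl | ⟨s', rfl, hs'⟩, ht, hlt, rfl⟩
    · rw [ht.unique hk rfl]; exact .inl rfl
    · obtain ⟨t, rfl⟩ : ∃ t', t = t' + (k + 1) := ⟨t - (k + 1), by have := ht.le; omega⟩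
      have : t + (k + 1) < m + (k + 1) := by exact_mod_cast hlt
      exact .inr ⟨s', t, hs', isLastVisit_shift.1 ht, by exact_mod_cast (by omega : t < m), rfl⟩
  · rintro (rfl | ⟨s, t, hs, ht, hlt, rfl⟩)
    · exact ⟨0, k, .inl rfl, hk, by exact_mod_cast (by omega), rfl⟩
    · have hlt' : t < m := by exact_mod_cast hlt
      exact ⟨_, _, .inr ⟨s, rfl, hs⟩, isLastVisit_shift.2 ht,
        by exact_mod_cast (by omega : t + (k + 1) < m + (k + 1)), rfl⟩

/-! ### Hitting times -/

lemma le_hitTime_iff {B : Set V} {n : ℕ} :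
    (n : ℕ∞) ≤ G.hitTime x e B ↔ ∀ t < n, G.vertexAt x e t ∉ B := by
  simp only [hitTime, le_iInf_iff, Set.mem_ofPred_eq, Nat.cast_le]
  exact ⟨fun h t ht hB => absurd (h t hB) (not_le.2 ht), fun h t hB => not_lt.1 fun ht => h t ht hB⟩

lemma hitTime_le {B : Set V} {n : ℕ} (h : G.vertexAt x e n ∈ B) : G.hitTime x e B ≤ n :=
  iInf₂_le (f := fun (t : ℕ) (_ : t ∈ {t : ℕ | G.vertexAt x e t ∈ B}) => (t : ℕ∞)) n h

lemma hitTime_eq_coe_iff {B : Set V} {n : ℕ} :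
    G.hitTime x e B = n ↔ G.vertexAt x e n ∈ B ∧ ∀ t < n, G.vertexAt x e t ∉ B := by
  constructor
  · intro h
    have h1 := G.le_hitTime_iff.1 h.ge
    refine ⟨?_, h1⟩
    by_contra hn
    have : ((n + 1 : ℕ) : ℕ∞) ≤ G.hitTime x e B := G.le_hitTime_iff.2 fun t ht =>
      (Nat.lt_succ_iff_lt_or_eq.1 ht).elim (h1 t) fun h => h ▸ hn
    rw [h] at this
    exact absurd (Nat.cast_le.1 this) (by omega)
  · rintro ⟨h1, h2⟩
    exact le_antisymm (G.hitTime_le h1) (G.le_hitTime_iff.2 h2)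

lemma exists_hitTime_eq {B : Set V} (h : ∃ t, G.vertexAt x e t ∈ B) :
    ∃ n : ℕ, G.hitTime x e B = n := by
  obtain ⟨t, ht⟩ := h
  have : G.hitTime x e B ≠ ⊤ := fun h' => by simpa [h'] using G.hitTime_le ht
  exact ⟨_, (ENat.natCast_toNat this).symm⟩

lemma hitTime_eq_zero {B : Set V} (h : x ∈ B) : G.hitTime x e B = 0 := by
  have := (G.hitTime_eq_coe_iff (e := e) (n := 0)).2 ⟨h, fun t ht => absurd ht (by omega)⟩
  exact_mod_cast this

lemma loopErasureEdges_zero : G.loopErasureEdges x e 0 = ∅ := by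
  ext a
  simp [loopErasureEdges]

end LoopErasure

/-! ### Wilson's algorithm with a prescribed initial vertex set -/

section Stage

variable {V E : Type*}

/-- Wilson's algorithm started from the vertex set `B` (and no edges) in place of the empty digraph.
For `B = ∅` this is Wilson's algorithm rooted at infinity; for `B = Wᶜ` with `W` finite, it is
Wilson's algorithm on the wired digraph `G_W^*` rooted at its boundary vertex. -/
noncomputable def stageFrom (G : MultiDigraph V E) (B : Set V) (v : ℕ → V) (X : ℕ → ℕ → E) :
    ℕ → Set V × Set E
  | 0 => (B, ∅)
  | j + 1 =>
    ((stageFrom G B v X j).1 ∪ G.loopErasureVertices (v j) (X j)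
        (G.hitTime (v j) (X j) (stageFrom G B v X j).1),
      (stageFrom G B v X j).2 ∪ G.loopErasureEdges (v j) (X j)
        (G.hitTime (v j) (X j) (stageFrom G B v X j).1))

/-- The edge set of the output of `stageFrom`. -/
noncomputable def outputFrom (G : MultiDigraph V E) (B : Set V) (v : ℕ → V) (X : ℕ → ℕ → E) :
    Set E :=
  ⋃ j, (G.stageFrom B v X j).2

variable (G : MultiDigraph V E)

lemma stageFrom_empty (v : ℕ → V) (X : ℕ → ℕ → E) (j : ℕ) :
    G.stageFrom ∅ v X j = G.wilsonStage v X j := by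
  induction j with
  | zero => rfl
  | succ j ih => rw [stageFrom, ih]; rfl

lemma outputFrom_empty (v : ℕ → V) (X : ℕ → ℕ → E) :
    G.outputFrom ∅ v X = G.wilsonOutput v X := by
  simp only [outputFrom, wilsonOutput, stageFrom_empty]

end Stage

/-! ### Measurability -/

section Measurability

lemma measurable_config {E Ω : Type*} [MeasurableSpace Ω] {A : Ω → Set E}
    (hA : ∀ a, Measurable fun ω => a ∈ A ω) : Measurable fun ω => config (A ω) := by
  classical
  refine measurable_pi_lambda _ fun a => measurable_to_bool ?_
  have : (fun ω => config (A ω) a) ⁻¹' {true} = {ω | a ∈ A ω} := by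
    ext ω; simp [config]
  rw [this]
  exact measurableSet_setOfPred.2 (hA a)

lemma isLoopErasureTime_succ_iff {V : Type*} {γ : ℕ → V} {N : ℕ∞} {t : ℕ} :
    IsLoopErasureTime γ N (t + 1) ↔
      ∃ s : Fin (t + 1), IsLoopErasureTime γ N s ∧ IsLastVisit γ N s t ∧ (t : ℕ∞) < N := by
  constructor
  · intro h
    cases h with
    | @next s _ hs ht hlt => exact ⟨⟨s, Nat.lt_succ_of_le ht.le⟩, hs, ht, hlt⟩
  · rintro ⟨s, hs, ht, hlt⟩
    exact hs.next ht hlt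

variable {V E : Type*} [MeasurableSpace E]

variable [DiscreteMeasurableSpace E] (G : MultiDigraph V E) (x : V)

lemma measurable_vertexAt_eq (t : ℕ) (u : V) :
    Measurable fun e : ℕ → E => G.vertexAt x e t = u := by
  cases t with
  | zero => exact measurable_const (a := x = u)
  | succ t =>
    exact (Measurable.of_discrete (f := fun a : E => G.head a = u)).comp
      (measurable_pi_apply (X := fun _ : ℕ => E) t)

variable [Countable V]

lemma measurable_vertexAt_eq_vertexAt (s t : ℕ) :
    Measurable fun e : ℕ → E => G.vertexAt x e s = G.vertexAt x e t := by
  have : (fun e : ℕ → E => G.vertexAt x e s = G.vertexAt x e t) =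
      fun e => ∃ u, G.vertexAt x e s = u ∧ G.vertexAt x e t = u := by
    funext e; simp [eq_comm]
  rw [this]
  exact .exists fun u =>
    (G.measurable_vertexAt_eq x s u).and (G.measurable_vertexAt_eq x t u)

lemma measurable_isLastVisit (N : ℕ∞) (s t : ℕ) :
    Measurable fun e : ℕ → E => IsLastVisit (G.vertexAt x e) N s t := by
  have h : ∀ r, Measurable fun e : ℕ → E =>
      s ≤ r ∧ (r : ℕ∞) ≤ N ∧ G.vertexAt x e r = G.vertexAt x e s := fun r =>
    measurable_const.and (measurable_const.and (G.measurable_vertexAt_eq_vertexAt x r s))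
  exact (h t).and (.forall fun r => (h r).imp measurable_const)

lemma measurable_isLoopErasureTime (N : ℕ∞) (s : ℕ) :
    Measurable fun e : ℕ → E => IsLoopErasureTime (G.vertexAt x e) N s := by
  induction s using Nat.strong_induction_on with
  | _ s ih =>
    cases s with
    | zero => simp [IsLoopErasureTime.zero]
    | succ t =>
      simp only [isLoopErasureTime_succ_iff]
      exact .exists fun s =>
        (ih s s.2).and ((G.measurable_isLastVisit x N s t).and measurable_const)

lemma measurable_mem_loopErasureVertices (N : ℕ∞) (u : V) :
    Measurable fun e : ℕ → E => u ∈ G.loopErasureVertices x e N :=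
  .exists fun s => (G.measurable_isLoopErasureTime x N s).and (G.measurable_vertexAt_eq x s u)

lemma measurable_mem_loopErasureEdges (N : ℕ∞) (a : E) :
    Measurable fun e : ℕ → E => a ∈ G.loopErasureEdges x e N :=
  .exists fun s => .exists fun t => (G.measurable_isLoopErasureTime x N s).and <|
    (G.measurable_isLastVisit x N s t).and <| measurable_const.and <|
      (Measurable.of_discrete (f := fun b : E => b = a)).comp (measurable_pi_apply t)

variable {Ω : Type*} [MeasurableSpace Ω] {A : Ω → Set V} {Y : Ω → ℕ → E}

lemma measurable_vertexAt_mem (hA : ∀ u, Measurable fun ω => u ∈ A ω) (hY : Measurable Y) (t : ℕ) :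
    Measurable fun ω => G.vertexAt x (Y ω) t ∈ A ω := by
  have : (fun ω => G.vertexAt x (Y ω) t ∈ A ω) =
      fun ω => ∃ u, G.vertexAt x (Y ω) t = u ∧ u ∈ A ω := by
    funext ω; simp
  rw [this]
  exact .exists fun u => ((G.measurable_vertexAt_eq x t u).comp hY).and (hA u)

lemma measurable_hitTime_eq (hA : ∀ u, Measurable fun ω => u ∈ A ω) (hY : Measurable Y) (N : ℕ∞) :
    Measurable fun ω => G.hitTime x (Y ω) (A ω) = N := by
  have h := G.measurable_vertexAt_mem x hA hY
  induction N using ENat.recTopCoe with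
  | top =>
    have : (fun ω => G.hitTime x (Y ω) (A ω) = ⊤) = fun ω => ∀ t, ¬ G.vertexAt x (Y ω) t ∈ A ω := by
      funext ω
      simp [hitTime]
    rw [this]
    exact .forall fun t => (h t).not
  | coe n =>
    simp only [hitTime_eq_coe_iff]
    exact (h n).and (.forall fun t => measurable_const.imp (h t).not)

lemma measurable_mem_loopErasureVertices_hitTime (hA : ∀ u, Measurable fun ω => u ∈ A ω)
    (hY : Measurable Y) (u : V) :
    Measurable fun ω => u ∈ G.loopErasureVertices x (Y ω) (G.hitTime x (Y ω) (A ω)) := by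
  have : (fun ω => u ∈ G.loopErasureVertices x (Y ω) (G.hitTime x (Y ω) (A ω))) =
      fun ω => ∃ N, G.hitTime x (Y ω) (A ω) = N ∧ u ∈ G.loopErasureVertices x (Y ω) N := by
    funext ω; simp
  rw [this]
  exact .exists fun N => (G.measurable_hitTime_eq x hA hY N).and
    ((G.measurable_mem_loopErasureVertices x N u).comp hY)

lemma measurable_mem_loopErasureEdges_hitTime (hA : ∀ u, Measurable fun ω => u ∈ A ω)
    (hY : Measurable Y) (a : E) :
    Measurable fun ω => a ∈ G.loopErasureEdges x (Y ω) (G.hitTime x (Y ω) (A ω)) := by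
  have : (fun ω => a ∈ G.loopErasureEdges x (Y ω) (G.hitTime x (Y ω) (A ω))) =
      fun ω => ∃ N, G.hitTime x (Y ω) (A ω) = N ∧ a ∈ G.loopErasureEdges x (Y ω) N := by
    funext ω; simp
  rw [this]
  exact .exists fun N => (G.measurable_hitTime_eq x hA hY N).and
    ((G.measurable_mem_loopErasureEdges x N a).comp hY)

lemma measurable_mem_stageFrom (B : Set V) (v : ℕ → V) (j : ℕ) :
    (∀ u, Measurable fun X => u ∈ (G.stageFrom B v X j).1) ∧
      ∀ a, Measurable fun X => a ∈ (G.stageFrom B v X j).2 := by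
  induction j with
  | zero => exact ⟨fun u => measurable_const, fun a => measurable_const⟩
  | succ j ih =>
    exact ⟨fun u => (ih.1 u).or
        (G.measurable_mem_loopErasureVertices_hitTime (v j) ih.1 (measurable_pi_apply j) u),
      fun a => (ih.2 a).or
        (G.measurable_mem_loopErasureEdges_hitTime (v j) ih.1 (measurable_pi_apply j) a)⟩

lemma measurable_config_outputFrom (B : Set V) (v : ℕ → V) :
    Measurable fun X => config (G.outputFrom B v X) := by
  refine measurable_config fun a => ?_
  simp only [outputFrom, Set.mem_iUnion]
  exact .exists fun j => (G.measurable_mem_stageFrom B v j).2 a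

end Measurability

/-! ### Transient paths -/

section TransientPath

variable {V E : Type*} (G : MultiDigraph V E)

/-- A directed path that visits each vertex finitely often. -/
structure IsTransientPath (x : V) (e : ℕ → E) : Prop where
  isPath : G.IsPath x e
  finite_visits : ∀ u, {t : ℕ | G.vertexAt x e t = u}.Finite

variable {G}

lemma IsTransientPath.exists_notMem {x : V} {e : ℕ → E} (h : G.IsTransientPath x e)
    (S : Finset V) : ∃ t, G.vertexAt x e t ∉ S := by
  by_contra! hS
  refine Set.infinite_univ (α := ℕ) (((S.finite_toSet.biUnion
    fun u _ => h.finite_visits u)).subset fun t _ => ?_)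
  exact Set.mem_biUnion (Finset.mem_coe.2 (hS t)) rfl

lemma IsTransientPath.shift {x : V} {e : ℕ → E} (h : G.IsTransientPath x e) (k : ℕ) :
    G.IsTransientPath (G.head (e k)) (fun i => e (i + (k + 1))) where
  isPath t := by rw [G.vertexAt_shift x e]; exact h.isPath _
  finite_visits u := by
    simp only [G.vertexAt_shift x e]
    exact (h.finite_visits u).preimage (fun a _ b _ hab => Nat.add_right_cancel hab)

lemma ae_isTransientPath [Countable E] [MeasurableSpace E] [DiscreteMeasurableSpace E]
    {hloc : G.LocallyFinite} {hout : G.NoSinks} (htrans : G.Transient hloc hout) (x : V) :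
    ∀ᵐ e ∂(G.walkLaw hloc hout x), G.IsTransientPath x e := by
  filter_upwards [G.ae_isPath hloc hout x, htrans x] with e h1 h2
  exact ⟨h1, h2⟩

end TransientPath

/-! ### Cramer's rule for the killed walk -/

section Cramer

/-- Cramer's rule for one coordinate of the solution of `A h = c δ_i`. -/
lemma det_mul_eq_of_mulVec_eq_single {ι R : Type*} [Fintype ι] [DecidableEq ι] [CommRing R]
    {A : Matrix ι ι R} {h : ι → R} {i : ι} {c : R} (hA : A.mulVec h = Pi.single i c) :
    A.det * h i = c * (A.updateRow i (Pi.single i 1)).det := by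
  have h1 : A.adjugate.mulVec (A.mulVec h) = A.det • h := by
    rw [Matrix.mulVec_mulVec, Matrix.adjugate_mul, Matrix.smul_mulVec, Matrix.one_mulVec]
  have h2 := congrFun h1 i
  rw [hA, Matrix.mulVec_single, Pi.smul_apply, Pi.smul_apply, smul_eq_mul] at h2
  rw [← h2, ← Matrix.adjugate_apply]
  simp [mul_comm]

variable {V E : Type*} (G : MultiDigraph V E) (hloc : G.LocallyFinite)

/-- The finite set of edges going out of `u`. -/
noncomputable def outFinset (u : V) : Finset E := (hloc u).2.toFinset

lemma mem_outFinset {u : V} {a : E} : a ∈ G.outFinset hloc u ↔ G.tail a = u := by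
  simp [outFinset, outEdges]

/-- The probability that the random walk steps from `u` to `w`. -/
noncomputable def stepProb [DecidableEq V] (u w : V) : ℝ :=
  ((G.outFinset hloc u).filter fun a => G.head a = w).card * ((G.outFinset hloc u).card : ℝ)⁻¹

variable [DecidableEq V]

/-- The matrix `1 - P` of the walk killed outside `S`, where `S` is a subset of `W`. It is indexed
by `W` for all `S`, the rows outside `S` being those of the identity matrix; thus removing a vertex
from `S` amounts to updating a row. -/
noncomputable def killedMatrix (W S : Finset V) : Matrix W W ℝ := fun i j =>
  (1 : Matrix W W ℝ) i j - if (i : V) ∈ S then G.stepProb hloc i j else 0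

lemma killedMatrix_updateRow {W S : Finset V} (x : W) :
    (G.killedMatrix hloc W S).updateRow x (Pi.single x 1) =
      G.killedMatrix hloc W (S.erase x) := by
  ext i j
  by_cases hi : i = x
  · subst hi
    simp [killedMatrix, Matrix.one_apply, Pi.single_apply, eq_comm]
  · have hi' : (i : V) ≠ x := fun h => hi (Subtype.ext h)
    simp [killedMatrix, Matrix.updateRow_ne hi, hi']

lemma killedMatrix_empty (W : Finset V) : G.killedMatrix hloc W ∅ = 1 := by
  ext i j
  simp [killedMatrix]

/-- Averaging over the edges out of `u` a function of the head that vanishes outside `W` amounts to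
summing over `W` with the transition probabilities as weights. -/
lemma sum_outFinset_head (W : Finset V) (u : V) {h : V → ℝ} (hh : ∀ w ∉ W, h w = 0) :
    ∑ a ∈ G.outFinset hloc u, ((G.outFinset hloc u).card : ℝ)⁻¹ * h (G.head a) =
      ∑ w : W, G.stepProb hloc u w * h w := by
  rw [Finset.sum_coe_sort W fun w => G.stepProb hloc u w * h w]
  have h1 : ∀ a ∈ G.outFinset hloc u, ((G.outFinset hloc u).card : ℝ)⁻¹ * h (G.head a) =
      ∑ w ∈ W, if G.head a = w then ((G.outFinset hloc u).card : ℝ)⁻¹ * h w else 0 := by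
    intro a _
    rw [Finset.sum_ite_eq]
    split_ifs with ha
    · rfl
    · rw [hh _ ha, mul_zero]
  rw [Finset.sum_congr rfl h1, Finset.sum_comm]
  refine Finset.sum_congr rfl fun w _ => ?_
  rw [← Finset.sum_filter, Finset.sum_const, stepProb, nsmul_eq_mul, mul_assoc]

end Cramer

section FirstStep

variable {V E : Type*} [Countable E] [MeasurableSpace E] [DiscreteMeasurableSpace E]
  (G : MultiDigraph V E) (hloc : G.LocallyFinite) (hout : G.NoSinks)

lemma uniformOn_outEdges_singleton {u : V} {a : E} (ha : G.tail a = u) :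
    uniformOn (G.outEdges u) {a} = ((G.outFinset hloc u).card : ENNReal)⁻¹ := by
  classical
  have : G.outEdges u = (G.outFinset hloc u : Set E) := by ext b; simp [outFinset]
  rw [this, ← Finset.coe_singleton, uniformOn_apply_finset, Finset.inter_singleton_of_mem
    ((G.mem_outFinset hloc).2 ha)]
  simp

lemma walkLaw_real_firstStep (x : V) {B : Set (ℕ → E)} (hB : MeasurableSet B) :
    (G.walkLaw hloc hout x).real B = ∑ a ∈ G.outFinset hloc x,
      ((G.outFinset hloc x).card : ℝ)⁻¹ * (G.walkLaw hloc hout (G.head a)).real (cons a ⁻¹' B) := by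
  have := G.isProbabilityMeasure_walkLaw hloc hout
  rw [Measure.real, walkLaw_firstStep _ _ _ _ hB, tsum_eq_sum (s := G.outFinset hloc x),
    ENNReal.toReal_sum]
  · refine Finset.sum_congr rfl fun a ha => ?_
    rw [G.uniformOn_outEdges_singleton hloc ((G.mem_outFinset hloc).1 ha)]
    simp [Measure.real]
  · intro a ha
    rw [G.uniformOn_outEdges_singleton hloc ((G.mem_outFinset hloc).1 ha)]
    have h0 : ((G.outFinset hloc x).card : ENNReal) ≠ 0 := by
      simpa using (Finset.card_pos.2 ⟨a, ha⟩).ne'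
    exact ENNReal.mul_ne_top (ENNReal.inv_ne_top.2 h0) (measure_ne_top _ _)
  · intro a ha
    have : uniformOn (G.outEdges x) {a} = 0 := by
      rw [uniformOn_eq_zero_iff (hloc x).2]
      ext b
      simp only [outEdges, Set.mem_inter_iff, Set.mem_ofPred_eq, Set.mem_singleton_iff,
        Set.mem_empty_iff_false, iff_false]
      rintro ⟨h1, rfl⟩
      exact ha ((G.mem_outFinset hloc).2 h1)
    rw [this, zero_mul]

end FirstStep

/-! ### The loop-erased walk stopped outside a finite set -/

section StoppedWalk

variable {V E : Type*} (G : MultiDigraph V E)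

/-- The event that the loop-erasure of the walk from `x` stopped outside `S` uses only edges
of `T`. -/
def loopErasureEvent (T : Set E) (S : Finset V) (x : V) : Set (ℕ → E) :=
  {e | G.loopErasureEdges x e (G.hitTime x e (↑S)ᶜ) ⊆ T}

/-- The event that a walk from `z` leaves `S` without visiting `x`, and that its loop-erasure uses
only edges of `T`. -/
def avoidEvent [DecidableEq V] (T : Set E) (S : Finset V) (x z : V) : Set (ℕ → E) :=
  {e | (∃ n : ℕ, G.hitTime z e (↑(S.erase x))ᶜ = n ∧ G.vertexAt z e n ≠ x) ∧
    e ∈ G.loopErasureEvent T (S.erase x) z}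

/-- The event that the walk from `y` visits `x` before leaving `S`, crosses the edge `b` when it
leaves `x` for the last time, and has from then on a loop-erasure using only edges of `T`. -/
def lastExitEvent [DecidableEq V] (T : Set E) (S : Finset V) (x : V) (b : E) (y : V) :
    Set (ℕ → E) :=
  {e | ∃ t : ℕ, (∀ r ≤ t, G.vertexAt y e r ∈ S) ∧ G.vertexAt y e t = x ∧ e t = b ∧
    (fun i => e (i + (t + 1))) ∈ G.avoidEvent T S x (G.head b)}

variable {G}

/-- A walk that leaves `S` decomposes at the last visit to its starting point `x ∈ S`. -/
lemma exists_last_exit [DecidableEq V] {S : Finset V} {x : V} {e : ℕ → E} (hx : x ∈ S)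
    (he : G.IsTransientPath x e) :
    ∃ k m : ℕ, G.hitTime x e (↑S)ᶜ = ((m + (k + 1) : ℕ) : ℕ∞) ∧
      IsLastVisit (G.vertexAt x e) ((m + (k + 1) : ℕ) : ℕ∞) 0 k ∧
      G.hitTime (G.head (e k)) (fun i => e (i + (k + 1))) (↑(S.erase x))ᶜ = (m : ℕ∞) := by
  obtain ⟨n, hn⟩ := G.exists_hitTime_eq (x := x) (e := e) (B := (↑S)ᶜ)
    (by simpa using he.exists_notMem S)
  obtain ⟨hn1, hn2⟩ := G.hitTime_eq_coe_iff.1 hn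
  obtain ⟨k, hk⟩ := exists_isLastVisit (γ := G.vertexAt x e) (N := n) (s := 0) bot_le
    (.inl (ENat.natCast_ne_top n))
  have hkn : k < n := by
    refine lt_of_le_of_ne (by exact_mod_cast hk.le_length) ?_
    rintro rfl
    exact hn1 (by rw [hk.eq]; simpa [vertexAt] using hx)
  obtain ⟨m, rfl⟩ : ∃ m, n = m + (k + 1) := ⟨n - (k + 1), by omega⟩
  refine ⟨k, m, hn, hk, G.hitTime_eq_coe_iff.2 ⟨?_, fun t ht => ?_⟩⟩
  · rw [G.vertexAt_shift x e]
    simp only [Set.mem_compl_iff, Finset.mem_coe, Finset.mem_erase, not_and] at hn1 ⊢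
    exact fun _ => hn1
  · rw [G.vertexAt_shift x e]
    have h1 := hn2 (t + (k + 1)) (by omega)
    simp only [Set.mem_compl_iff, Finset.mem_coe, Finset.mem_erase, not_not] at h1 ⊢
    refine ⟨fun h => ?_, h1⟩
    have := hk.time_le (r := t + (k + 1)) (by exact_mod_cast (by omega)) h
    omega

/-- First-step decomposition of the last-exit event: either the first step is already the last exit
from `x`, or the last exit comes later. -/
lemma cons_mem_lastExitEvent_iff [DecidableEq V] {T : Set E} {S : Finset V} {x y : V} {a b : E}
    {e : ℕ → E} (hy : y ∈ S) :
    cons a e ∈ G.lastExitEvent T S x b y ↔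
      (y = x ∧ a = b ∧ e ∈ G.avoidEvent T S x (G.head b)) ∨
        e ∈ G.lastExitEvent T S x b (G.head a) := by
  constructor
  · rintro ⟨_ | t, h1, h2, h3, h4⟩
    · exact .inl ⟨h2, h3, h4⟩
    · refine .inr ⟨t, fun r hr => ?_, ?_, h3, h4⟩
      · rw [← vertexAt_cons_succ G y]; exact h1 _ (by omega)
      · rw [← vertexAt_cons_succ G y]; exact h2
  · rintro (⟨rfl, rfl, h⟩ | ⟨t, h1, h2, h3, h4⟩)
    · refine ⟨0, fun r hr => ?_, rfl, rfl, h⟩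
      obtain rfl : r = 0 := by omega
      exact hy
    · refine ⟨t + 1, ?_, by rw [vertexAt_cons_succ]; exact h2, h3, h4⟩
      rintro (_ | r) hr
      · exact hy
      · rw [vertexAt_cons_succ]; exact h1 r (by omega)

/-- A walk that leaves `S` without visiting `x` does not visit `x` before leaving `S`: the two
alternatives in `cons_mem_lastExitEvent_iff` exclude each other. -/
lemma disjoint_avoidEvent_lastExitEvent [DecidableEq V] {T : Set E} {S : Finset V} {x z : V}
    {b : E} : Disjoint (G.avoidEvent T S x z) (G.lastExitEvent T S x b z) := by
  rw [Set.disjoint_left]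
  rintro e ⟨⟨n, hn, hnx⟩, -⟩ ⟨t, h1, h2, -⟩
  obtain ⟨hn1, hn2⟩ := G.hitTime_eq_coe_iff.1 hn
  rcases lt_or_ge t n with h | h
  · exact hn2 t h (by simp [h2])
  · exact hn1 (by simp [hnx, h1 n h])

lemma lastExitEvent_eq_empty [DecidableEq V] {T : Set E} {S : Finset V} {x y : V} {b : E}
    (hy : y ∉ S) : G.lastExitEvent T S x b y = ∅ := by
  rw [Set.eq_empty_iff_forall_notMem]
  rintro e ⟨t, h, -⟩
  exact hy (h 0 (Nat.zero_le t))

/-- If `b` is the only edge of `T` out of `x`, then the loop-erasure of the stopped walk from `x`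
uses only edges of `T` precisely if the walk crosses `b` when it leaves `x` for the last time and
has from then on a loop-erasure in `T`. -/
lemma mem_loopErasureEvent_iff [DecidableEq V] {T : Set E} {S : Finset V} {x : V} {b : E}
    {e : ℕ → E} (hb : b ∈ T) (hbT : ∀ a ∈ T, G.tail a = x → a = b) (hx : x ∈ S)
    (he : G.IsTransientPath x e) :
    e ∈ G.loopErasureEvent T S x ↔ e ∈ G.lastExitEvent T S x b x := by
  constructor
  · intro h
    obtain ⟨k, m, hn, hk, hm⟩ := exists_last_exit hx he
    rw [loopErasureEvent, Set.mem_ofPred_eq, hn, G.loopErasureEdges_eq_insert hk,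
      Set.insert_subset_iff] at h
    have hek : e k = b := hbT _ h.1 ((he.isPath k).trans hk.eq)
    obtain ⟨hn1, hn2⟩ := G.hitTime_eq_coe_iff.1 hn
    refine ⟨k, fun r hr => by simpa using hn2 r (by omega), hk.eq, hek, ⟨m, ?_, ?_⟩, ?_⟩
    · rw [← hek]; exact hm
    · rw [← hek, G.vertexAt_shift x e]
      intro h'
      exact hn1 (by rw [h']; exact hx)
    · rw [loopErasureEvent, Set.mem_ofPred_eq, ← hek, hm]
      exact h.2
  · rintro ⟨t, h1, h2, h3, ⟨m, hm, hmx⟩, h4⟩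
    rw [loopErasureEvent, Set.mem_ofPred_eq, hm] at h4
    obtain ⟨hm1, hm2⟩ := G.hitTime_eq_coe_iff.1 hm
    rw [← h3] at hm1 hm2 hmx h4
    simp only [G.vertexAt_shift x e] at hm1 hm2 hmx
    have hmS : G.vertexAt x e (m + (t + 1)) ∉ S := by simpa [hmx] using hm1
    have hn : G.hitTime x e (↑S)ᶜ = ((m + (t + 1) : ℕ) : ℕ∞) := by
      refine G.hitTime_eq_coe_iff.2 ⟨hmS, fun r hr => ?_⟩
      rcases le_or_gt r t with hrt | hrt
      · simpa using h1 r hrt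
      · obtain ⟨r, rfl⟩ : ∃ r', r = r' + (t + 1) := ⟨r - (t + 1), by omega⟩
        have := hm2 r (by omega)
        simp only [Set.mem_compl_iff, Finset.mem_coe, Finset.mem_erase, not_not] at this ⊢
        exact this.2
    have hk : IsLastVisit (G.vertexAt x e) ((m + (t + 1) : ℕ) : ℕ∞) 0 t := by
      refine ⟨⟨Nat.zero_le t, by exact_mod_cast (by omega), h2⟩, ?_⟩
      rintro r ⟨-, hr, hrx⟩
      have hr' : r ≤ m + (t + 1) := by exact_mod_cast hr
      by_contra! hlt
      obtain ⟨r, rfl⟩ : ∃ r', r = r' + (t + 1) := ⟨r - (t + 1), by omega⟩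
      rcases (show r ≤ m by omega).eq_or_lt with rfl | hrm
      · exact hmx hrx
      · have := hm2 r hrm
        simp only [Set.mem_compl_iff, Finset.mem_coe, Finset.mem_erase, not_not] at this
        exact this.1 hrx
    rw [loopErasureEvent, Set.mem_ofPred_eq, hn, G.loopErasureEdges_eq_insert hk,
      Set.insert_subset_iff]
    exact ⟨h3 ▸ hb, h4⟩

/-- A loop-erasure in an acyclic edge set that contains an edge `b` from `x` to the starting point
does not end at `x`. -/
lemma mem_avoidEvent_iff [DecidableEq V] {T : Set E} {S : Finset V} {b : E} {e : ℕ → E}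
    (hb : b ∈ T) (hT : ∀ u, ¬ Relation.TransGen (G.Step T) u u)
    (he : G.IsTransientPath (G.head b) e) :
    e ∈ G.avoidEvent T S (G.tail b) (G.head b) ↔
      e ∈ G.loopErasureEvent T (S.erase (G.tail b)) (G.head b) := by
  refine ⟨fun h => h.2, fun h => ⟨?_, h⟩⟩
  obtain ⟨n, hn⟩ := G.exists_hitTime_eq (x := G.head b) (e := e) (B := (↑(S.erase (G.tail b)))ᶜ)
    (by simpa only [Set.mem_compl_iff, Finset.mem_coe] using he.exists_notMem _)
  refine ⟨n, hn, fun hnx => ?_⟩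
  rw [loopErasureEvent, Set.mem_ofPred_eq, hn] at h
  have hr := G.loopErasureVertices_reaches_end (n := n) he.isPath G.start_mem_loopErasureVertices
  rw [hnx] at hr
  exact hT (G.tail b) (.head' ⟨b, hb, rfl, rfl⟩
    (Relation.ReflTransGen.mono (fun u w ⟨a, ha, hs⟩ => ⟨a, h ha, hs⟩) _ _ hr))

end StoppedWalk

/-! ### The law of the loop-erased walk -/

section SingleWalk

variable {V E : Type*} [Countable V] [Countable E] [MeasurableSpace E]
  [DiscreteMeasurableSpace E] (G : MultiDigraph V E)

lemma measurableSet_loopErasureEvent (T : Set E) (S : Finset V) (x : V) :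
    MeasurableSet (G.loopErasureEvent T S x) :=
  measurableSet_setOfPred.2 <| .forall fun a =>
    (G.measurable_mem_loopErasureEdges_hitTime x (A := fun _ => (↑S)ᶜ)
      (fun _ => measurable_const) measurable_id a).imp measurable_const

variable [DecidableEq V]

lemma measurableSet_avoidEvent (T : Set E) (S : Finset V) (x z : V) :
    MeasurableSet (G.avoidEvent T S x z) := by
  refine MeasurableSet.inter (measurableSet_setOfPred.2 <| .exists fun n => ?_)
    (G.measurableSet_loopErasureEvent T _ z)
  exact (G.measurable_hitTime_eq z (A := fun _ => (↑(S.erase x))ᶜ)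
    (fun _ => measurable_const) measurable_id n).and (G.measurable_vertexAt_eq z n x).not

lemma measurableSet_lastExitEvent (T : Set E) (S : Finset V) (x : V) (b : E) (y : V) :
    MeasurableSet (G.lastExitEvent T S x b y) := by
  have hshift : ∀ t : ℕ, Measurable fun (e : ℕ → E) (i : ℕ) => e (i + (t + 1)) := fun t =>
    measurable_pi_lambda _ fun i => measurable_pi_apply _
  refine measurableSet_setOfPred.2 <| .exists fun t => ?_
  refine (Measurable.forall fun r => measurable_const.imp ?_).and <|
    (G.measurable_vertexAt_eq y t x).and <| Measurable.and ?_ ?_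
  · exact G.measurable_vertexAt_mem y (A := fun _ => (S : Set V)) (fun _ => measurable_const)
      measurable_id r
  · exact (Measurable.of_discrete (f := fun a : E => a = b)).comp
      (measurable_pi_apply (X := fun _ : ℕ => E) t)
  · exact measurableSet_setOfPred.1 ((G.measurableSet_avoidEvent T S x (G.head b)).preimage
      (hshift t))

variable (hloc : G.LocallyFinite) (hout : G.NoSinks)

/-- The probabilities `h y` of the last-exit event solve the linear system `(1 - P) h = c δ_x` on
`S`; Cramer's rule then expresses `h x` through determinants. -/
lemma det_mul_walkLaw_lastExitEvent (T : Set E) {W S : Finset V} (hSW : S ⊆ W) {b : E}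
    (hb : G.tail b ∈ S) :
    (G.killedMatrix hloc W S).det *
        (G.walkLaw hloc hout (G.tail b)).real (G.lastExitEvent T S (G.tail b) b (G.tail b)) =
      ((G.outFinset hloc (G.tail b)).card : ℝ)⁻¹ *
        (G.walkLaw hloc hout (G.head b)).real (G.avoidEvent T S (G.tail b) (G.head b)) *
          (G.killedMatrix hloc W (S.erase (G.tail b))).det := by
  classical
  have := G.isProbabilityMeasure_walkLaw hloc hout
  set x := G.tail b with hx
  set κ := (G.walkLaw hloc hout (G.head b)).real (G.avoidEvent T S x (G.head b)) with hκ
  set h : V → ℝ := fun y => (G.walkLaw hloc hout y).real (G.lastExitEvent T S x b y) with hh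
  have hzero : ∀ y ∉ S, h y = 0 := fun y hy => by
    simp [hh, lastExitEvent_eq_empty hy]
  -- First-step analysis; the extra term for `y = x` is the walk that leaves `x` through `b` for the
  -- last time at its first step.
  have hstep : ∀ y ∈ S, h y = ∑ w : W, G.stepProb hloc y w * h w +
      if y = x then ((G.outFinset hloc x).card : ℝ)⁻¹ * κ else 0 := by
    intro y hy
    rw [← G.sum_outFinset_head hloc W y fun w hw => hzero w fun hwS => hw (hSW hwS)]
    have hterm : ∀ a ∈ G.outFinset hloc y, ((G.outFinset hloc y).card : ℝ)⁻¹ *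
        (G.walkLaw hloc hout (G.head a)).real (cons a ⁻¹' G.lastExitEvent T S x b y) =
        ((G.outFinset hloc y).card : ℝ)⁻¹ * h (G.head a) +
          if a = b then (if y = x then ((G.outFinset hloc x).card : ℝ)⁻¹ * κ else 0) else 0 := by
      intro a _
      by_cases hab : y = x ∧ a = b
      · obtain ⟨rfl, rfl⟩ := hab
        have hset : cons a ⁻¹' G.lastExitEvent T S x a x =
            G.avoidEvent T S x (G.head a) ∪ G.lastExitEvent T S x a (G.head a) := by
          ext e
          simp [cons_mem_lastExitEvent_iff hy]
        rw [hset, measureReal_union disjoint_avoidEvent_lastExitEvent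
          (G.measurableSet_lastExitEvent T S x a _)]
        simp only [if_true, hh, hκ]
        ring
      · have hset : cons a ⁻¹' G.lastExitEvent T S x b y =
            G.lastExitEvent T S x b (G.head a) := by
          ext e
          simp only [Set.mem_preimage, cons_mem_lastExitEvent_iff hy]
          tauto
        rw [hset]
        have : (if a = b then (if y = x then ((G.outFinset hloc x).card : ℝ)⁻¹ * κ else 0)
            else 0) = 0 := by
          split_ifs <;> tauto
        rw [this, add_zero]
    rw [hh]
    change (G.walkLaw hloc hout y).real _ = _
    rw [G.walkLaw_real_firstStep hloc hout y (G.measurableSet_lastExitEvent T S x b y),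
      Finset.sum_congr rfl hterm, Finset.sum_add_distrib, Finset.sum_ite_eq']
    congr 1
    by_cases hyx : y = x
    · rw [if_pos ((G.mem_outFinset hloc).2 (hx.symm.trans hyx.symm))]
    · simp [hyx]
  -- The rows of the matrix outside `S` say that `h` vanishes there.
  have hsys : (G.killedMatrix hloc W S).mulVec (fun w => h w) =
      Pi.single ⟨x, hSW hb⟩ (((G.outFinset hloc x).card : ℝ)⁻¹ * κ) := by
    funext y
    have hexp : (G.killedMatrix hloc W S).mulVec (fun w => h w) y =
        h y - if (y : V) ∈ S then ∑ w : W, G.stepProb hloc y w * h w else 0 := by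
      simp only [Matrix.mulVec, dotProduct, killedMatrix, sub_mul, Finset.sum_sub_distrib,
        Matrix.one_apply, ite_mul, one_mul, zero_mul, Finset.sum_ite_eq, Finset.mem_univ, if_true]
      split_ifs <;> simp
    rw [hexp, Pi.single_apply]
    by_cases hy : (y : V) ∈ S
    · rw [if_pos hy, hstep y hy, add_sub_cancel_left]
      simp [Subtype.ext_iff]
    · have : y ≠ ⟨x, hSW hb⟩ := fun h => hy (by rw [h]; exact hb)
      simp [hy, hzero y hy, this]
  have := det_mul_eq_of_mulVec_eq_single hsys
  rw [killedMatrix_updateRow] at this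
  exact this

variable {G hloc hout}

/-- The law of the loop-erased walk: let `T` be an acyclic edge set with exactly one edge `f u` out
of each vertex `u` of `W`, and let `S ⊆ W`. If the loop-erasure of the walk from `x` stopped outside
`S` uses only edges of `T`, then it visits a fixed set `P` of vertices of `S`, and this event has
probability `∏_{u ∈ P} 1 / deg u` times a ratio of determinants. -/
lemma exists_det_mul_walkLaw_loopErasureEvent (htrans : G.Transient hloc hout) {W : Finset V}
    {T : Set E} {f : V → E} (hf : ∀ u ∈ W, f u ∈ T ∧ G.tail (f u) = u)
    (hfT : ∀ a ∈ T, G.tail a ∈ W → a = f (G.tail a))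
    (hT : ∀ u, ¬ Relation.TransGen (G.Step T) u u) (S : Finset V) (hSW : S ⊆ W) (x : V) :
    ∃ P ⊆ S, (x ∈ S → x ∈ P) ∧
      (∀ e, G.IsTransientPath x e → e ∈ G.loopErasureEvent T S x →
        ∀ u ∈ S, u ∈ G.loopErasureVertices x e (G.hitTime x e (↑S)ᶜ) ↔ u ∈ P) ∧
      (G.killedMatrix hloc W S).det *
          (G.walkLaw hloc hout x).real (G.loopErasureEvent T S x) =
        (∏ u ∈ P, ((G.outFinset hloc u).card : ℝ)⁻¹) * (G.killedMatrix hloc W (S \ P)).det := by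
  have := G.isProbabilityMeasure_walkLaw hloc hout
  induction hn : S.card generalizing S x with
  | zero =>
    obtain rfl := Finset.card_eq_zero.1 hn
    refine ⟨∅, subset_rfl, id, by simp, ?_⟩
    have huniv : G.loopErasureEvent T ∅ x = Set.univ := by
      ext e
      simp [loopErasureEvent, G.hitTime_eq_zero, loopErasureEdges_zero]
    simp [huniv]
  | succ n ih =>
    by_cases hx : x ∈ S
    swap
    · refine ⟨∅, Finset.empty_subset _, fun h => absurd h hx, ?_, ?_⟩
      · intro e _ _ u hu
        have h0 := G.hitTime_eq_zero (x := x) (e := e) (B := (↑S)ᶜ) (by simpa using hx)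
        simp only [Finset.notMem_empty, iff_false]
        intro hu'
        rw [h0] at hu'
        obtain ⟨s, hs, rfl⟩ := G.exists_mem_loopErasureVertices_time hu'
        obtain rfl : s = 0 := by simpa using hs
        exact hx hu
      · have huniv : G.loopErasureEvent T S x = Set.univ := by
          ext e
          have h0 := G.hitTime_eq_zero (x := x) (e := e) (B := (↑S)ᶜ) (by simpa using hx)
          simp [loopErasureEvent, h0, loopErasureEdges_zero]
        simp [huniv]
    · obtain ⟨hfxT, hfx⟩ := hf x (hSW hx)
      -- The vertices visited in `S` are `x` and those visited in `S \ {x}` after the last exit from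
      -- `x`, through the edge `b = f x`.
      set b := f x with hb
      have hbT : ∀ a ∈ T, G.tail a = x → a = b := fun a ha hax => by
        rw [hfT a ha (hax ▸ hSW hx), hax]
      obtain ⟨P, hPS, -, hPv, hPd⟩ := ih (S.erase x) ((S.erase_subset x).trans hSW) (G.head b)
        (by rw [Finset.card_erase_of_mem hx, hn]; rfl)
      have hxP : x ∉ P := fun h => Finset.notMem_erase x S (hPS h)
      refine ⟨insert x P, Finset.insert_subset hx (hPS.trans (S.erase_subset x)),
        fun _ => Finset.mem_insert_self x P, ?_, ?_⟩
      · intro e he heT u hu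
        obtain ⟨k, m, hn, hk, hm⟩ := exists_last_exit hx he
        rw [loopErasureEvent, Set.mem_ofPred_eq, hn, G.loopErasureEdges_eq_insert hk,
          Set.insert_subset_iff] at heT
        have hek : e k = b := hbT _ heT.1 ((he.isPath k).trans hk.eq)
        have he' := he.shift k
        rw [hek] at he' hm
        have hev := hPv _ he' (by
          rw [loopErasureEvent, Set.mem_ofPred_eq, hm, ← hek]; exact heT.2) u
        rw [hm] at hev
        rw [hn, G.loopErasureVertices_eq_insert hk, Set.mem_insert_iff, Finset.mem_insert, hek]
        by_cases hux : u = x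
        · simp [hux]
        · simp only [hux, false_or]
          exact hev (Finset.mem_erase.2 ⟨hux, hu⟩)
      · have h1 : (G.walkLaw hloc hout x).real (G.loopErasureEvent T S x) =
            (G.walkLaw hloc hout x).real (G.lastExitEvent T S x b x) := by
          refine measureReal_congr ?_
          filter_upwards [ae_isTransientPath htrans x] with e he
          exact propext (mem_loopErasureEvent_iff hfxT hbT hx he)
        have h2 : (G.walkLaw hloc hout (G.head b)).real (G.avoidEvent T S x (G.head b)) =
            (G.walkLaw hloc hout (G.head b)).real
              (G.loopErasureEvent T (S.erase x) (G.head b)) := by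
          refine measureReal_congr ?_
          filter_upwards [ae_isTransientPath htrans (G.head b)] with e he
          have := mem_avoidEvent_iff (S := S) hfxT hT he
          rw [hfx] at this
          exact propext this
        have h3 := G.det_mul_walkLaw_lastExitEvent hloc hout T hSW (b := b) (hfx.symm ▸ hx)
        rw [hfx] at h3
        have hset : S.erase x \ P = S \ insert x P := by
          ext u
          simp only [Finset.mem_erase, Finset.mem_sdiff, Finset.mem_insert]
          tauto
        rw [h1, h3, h2, mul_assoc, mul_comm (Measure.real _ _), hPd, Finset.prod_insert hxP, hset,
          mul_assoc]

end SingleWalk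

/-! ### Arborescences of the wired digraph as edge sets -/

section WiredArborescence

variable {V E : Type*}

/-- The edge set `F` is that of a spanning in-arborescence of `G_W^*` rooted at the boundary vertex,
expressed in `G`: the tails of its edges lie in `W`, every vertex of `W` has out-degree one, and
every vertex is connected to the complement of `W` by a directed path. -/
structure IsWiredArborescence (G : MultiDigraph V E) (W : Finset V) (F : Set E) : Prop where
  tail_mem : ∀ a ∈ F, G.tail a ∈ W
  exists_out : ∀ u ∈ W, ∃ a ∈ F, G.tail a = u
  out_unique : ∀ a ∈ F, ∀ b ∈ F, G.tail a = G.tail b → a = b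
  exists_path : ∀ u, ∃ w ∉ W, Relation.ReflTransGen (G.Step F) u w

lemma collapse_of_mem {W : Finset V} {u : V} (h : u ∈ W) : collapse W u = some ⟨u, h⟩ := by
  simp [collapse, h]

lemma collapse_of_notMem {W : Finset V} {u : V} (h : u ∉ W) : collapse W u = none := by
  simp [collapse, h]

lemma collapse_eq_none {W : Finset V} {u : V} : collapse W u = none ↔ u ∉ W := by
  by_cases h : u ∈ W <;> simp [collapse, h]

lemma collapse_eq_some {W : Finset V} {u : V} {w : W} : collapse W u = some w ↔ u = w := by
  by_cases h : u ∈ W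
  · simp [collapse, h, Subtype.ext_iff]
  · simp only [collapse, h, dite_false, reduceCtorEq, false_iff]
    exact fun hu => h (hu ▸ w.2)

variable {G : MultiDigraph V E} {W : Finset V} {F : Set E}

/-- An edge set is the image of a spanning in-arborescence of the wired digraph if and only if it
is an arborescence in the sense of `IsWiredArborescence`. -/
lemma isWiredArborescence_iff :
    G.IsWiredArborescence W F ↔
      ∃ T, (G.wired W).IsSpanningInArborescence none T ∧ Subtype.val '' T = F := by
  constructor
  · intro h
    refine ⟨Subtype.val ⁻¹' F, ⟨?_, ?_, ?_⟩, ?_⟩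
    · rintro (_ | u) hu
      · exact absurd rfl hu
      · obtain ⟨a, ha, hau⟩ := h.exists_out u u.2
        refine ⟨⟨a, .inl (hau ▸ u.2)⟩, ⟨ha, collapse_eq_some.2 hau⟩, ?_⟩
        rintro ⟨b, _⟩ ⟨hb, hbu⟩
        exact Subtype.ext (h.out_unique b hb a ha ((collapse_eq_some.1 hbu).trans hau.symm))
    · rintro ⟨a, _⟩ ha hn
      exact collapse_eq_none.1 hn (h.tail_mem a ha)
    · have hlift : ∀ u w, Relation.ReflTransGen (G.Step F) u w →
          Relation.ReflTransGen ((G.wired W).Step (Subtype.val ⁻¹' F)) (collapse W u)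
            (collapse W w) := by
        intro u w huw
        refine huw.lift (collapse W) ?_
        rintro _ _ ⟨a, ha, rfl, rfl⟩
        exact ⟨⟨a, .inl (h.tail_mem a ha)⟩, ha, rfl, rfl⟩
      rintro (_ | u)
      · exact .refl
      · obtain ⟨w, hw, hp⟩ := h.exists_path u
        have := hlift _ _ hp
        rwa [collapse_of_mem u.2, collapse_of_notMem hw] at this
    · exact Set.image_preimage_eq_of_subset fun a ha => ⟨⟨a, .inl (h.tail_mem a ha)⟩, rfl⟩
  · rintro ⟨T, hT, rfl⟩
    have htail : ∀ a ∈ T, G.tail a.1 ∈ W := fun a ha => by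
      by_contra hn
      exact hT.root_out a ha (collapse_of_notMem hn)
    refine ⟨?_, ?_, ?_, ?_⟩
    · rintro _ ⟨a, ha, rfl⟩
      exact htail a ha
    · intro u hu
      obtain ⟨a, ⟨ha, hau⟩, -⟩ := hT.existsUnique_out (some ⟨u, hu⟩) (by simp)
      exact ⟨a, ⟨a, ha, rfl⟩, collapse_eq_some.1 hau⟩
    · rintro _ ⟨a, ha, rfl⟩ _ ⟨b, hb, rfl⟩ hab
      obtain ⟨c, -, hc⟩ := hT.existsUnique_out (some ⟨G.tail a, htail a ha⟩) (by simp)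
      rw [hc a ⟨ha, collapse_of_mem _⟩, hc b ⟨hb, collapse_eq_some.2 hab.symm⟩]
    · have key : ∀ c, Relation.ReflTransGen ((G.wired W).Step T) c none → ∀ u, collapse W u = c →
          ∃ w ∉ W, Relation.ReflTransGen (G.Step (Subtype.val '' T)) u w := by
        intro c hc
        induction hc using Relation.ReflTransGen.head_induction_on with
        | refl => exact fun u hu => ⟨u, collapse_eq_none.1 hu, .refl⟩
        | head hstep _ ih =>
          intro u hu
          obtain ⟨a, ha, hac, hac'⟩ := hstep
          obtain ⟨w, hw, hp⟩ := ih (G.head a) hac'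
          have hau : u = G.tail a := by
            have h1 : collapse W (G.tail a) = collapse W u := hac.trans hu.symm
            rw [collapse_of_mem (htail a ha)] at h1
            exact collapse_eq_some.1 h1.symm
          exact ⟨w, hw, hp.head ⟨a, ⟨a, ha, rfl⟩, hau.symm, rfl⟩⟩
      exact fun u => key _ (hT.path_to_root _) u rfl

/-- An arborescence has no directed cycle: a vertex on a cycle has its unique successor on a cycle
as well, so that the path leading to the complement of `W` could not leave the cycles. -/
lemma IsWiredArborescence.acyclic (h : G.IsWiredArborescence W F) (u : V) :
    ¬ Relation.TransGen (G.Step F) u u := by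
  intro hu
  obtain ⟨w, hw, hp⟩ := h.exists_path u
  have hcyc : Relation.TransGen (G.Step F) w w := by
    clear hw
    induction hp with
    | refl => exact hu
    | @tail y z _ hyz ih =>
      obtain ⟨z', hyz', hz'⟩ := Relation.TransGen.head'_iff.1 ih
      obtain ⟨a, ha, hay, rfl⟩ := hyz
      obtain ⟨b, hb, hby, rfl⟩ := hyz'
      obtain rfl := h.out_unique a ha b hb (hay.trans hby.symm)
      exact .tail' hz' ⟨a, ha, hay, rfl⟩
  obtain ⟨_, ⟨a, ha, haw, -⟩, -⟩ := Relation.TransGen.head'_iff.1 hcyc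
  exact hw (haw ▸ h.tail_mem a ha)

lemma IsWiredArborescence.eq_of_subset {F' : Set E} (h : G.IsWiredArborescence W F)
    (h' : G.IsWiredArborescence W F') (hFF : F ⊆ F') : F = F' := by
  refine hFF.antisymm fun a ha => ?_
  obtain ⟨b, hb, hba⟩ := h.exists_out _ (h'.tail_mem a ha)
  rwa [← h'.out_unique b (hFF hb) a ha hba]

lemma config_injective : Function.Injective (config (E := E)) := by
  intro A B h
  ext a
  simpa [config] using congrFun h a

lemma wiredUA_eq (G : MultiDigraph V E) [MeasurableSpace E] (W : Finset V) :
    G.wiredUA W = uniformOn (config '' {F | G.IsWiredArborescence W F}) := by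
  unfold wiredUA
  congr 1
  ext c
  simp only [Set.mem_image, Set.mem_ofPred_eq, isWiredArborescence_iff]
  constructor
  · rintro ⟨T, hT, rfl⟩; exact ⟨_, ⟨T, hT, rfl⟩, rfl⟩
  · rintro ⟨_, ⟨T, hT, rfl⟩, rfl⟩; exact ⟨T, hT, rfl⟩

lemma finite_wiredArborescence (hloc : G.LocallyFinite) (W : Finset V) :
    {F | G.IsWiredArborescence W F}.Finite := by
  have hfin : (⋃ u ∈ W, G.outEdges u).Finite := W.finite_toSet.biUnion fun u _ => (hloc u).2
  exact hfin.finite_subsets.subset fun F hF a ha =>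
    Set.mem_biUnion (Finset.mem_coe.2 (hF.tail_mem a ha)) rfl

end WiredArborescence

/-! ### Stages of Wilson's algorithm along fixed paths -/

section StagePaths

variable {V E : Type*} {G : MultiDigraph V E} {B : Set V} {v : ℕ → V} {X : ℕ → ℕ → E}

lemma stageFrom_mono : Monotone fun j => (G.stageFrom B v X j).1 :=
  monotone_nat_of_le_succ fun _ => Set.subset_union_left

lemma stageFrom_edges_mono : Monotone fun j => (G.stageFrom B v X j).2 :=
  monotone_nat_of_le_succ fun _ => Set.subset_union_left

lemma mem_stageFrom_succ (j : ℕ) : v j ∈ (G.stageFrom B v X (j + 1)).1 :=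
  .inr G.start_mem_loopErasureVertices

/-- The edges added at a stage go out of vertices that were not reached before. -/
lemma tail_notMem_stageFrom {x : V} {e : ℕ → E} {A : Set V} (hp : G.IsPath x e) {a : E}
    (ha : a ∈ G.loopErasureEdges x e (G.hitTime x e A)) : G.tail a ∉ A := by
  obtain ⟨t, ht, hta⟩ := G.exists_lt_tail_eq hp ha
  rw [← hta]
  exact fun h => absurd (G.hitTime_le h) (not_le.2 ht)

lemma tail_notMem_of_mem_stageFrom (hX : ∀ j, G.IsPath (v j) (X j)) {a : E} {j : ℕ}
    (ha : a ∈ (G.stageFrom B v X j).2) : G.tail a ∉ B := by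
  induction j with
  | zero => exact absurd ha (Set.notMem_empty a)
  | succ j ih =>
    rcases ha with ha | ha
    · exact ih ha
    · exact fun h => tail_notMem_stageFrom (hX j) ha (stageFrom_mono (Nat.zero_le j) h)

lemma tail_mem_of_mem_stageFrom (hX : ∀ j, G.IsPath (v j) (X j)) {a : E} {j : ℕ}
    (ha : a ∈ (G.stageFrom B v X j).2) : G.tail a ∈ (G.stageFrom B v X j).1 := by
  induction j with
  | zero => exact absurd ha (Set.notMem_empty a)
  | succ j ih =>
    rcases ha with ha | ha
    · exact .inl (ih ha)
    · exact .inr (G.tail_mem_loopErasureVertices (hX j) ha)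

/-- The edge of the output going out of `v j` is present from stage `j + 1` on. -/
lemma mem_outputFrom_iff (hX : ∀ j, G.IsPath (v j) (X j)) {a : E} {j : ℕ} (ha : G.tail a = v j) :
    a ∈ G.outputFrom B v X ↔ a ∈ (G.stageFrom B v X (j + 1)).2 := by
  refine ⟨fun h => ?_, fun h => Set.mem_iUnion.2 ⟨_, h⟩⟩
  obtain ⟨i, hi⟩ := Set.mem_iUnion.1 h
  induction i with
  | zero => exact absurd hi (Set.notMem_empty a)
  | succ i ih =>
    rcases le_or_gt (i + 1) (j + 1) with hij | hij
    · exact stageFrom_edges_mono hij hi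
    · rcases hi with hi | hi
      · exact ih hi
      · refine absurd ?_ (tail_notMem_stageFrom (hX i) hi)
        rw [ha]
        exact stageFrom_mono (show j + 1 ≤ i by omega) (mem_stageFrom_succ j)

/-- Every vertex reached by a stage is joined to the initial vertex set by a path of the edges
found so far, each vertex outside of the initial set having exactly one edge going out of it. -/
lemma stageFrom_arborescence {W : Finset V} (hX : ∀ j, G.IsTransientPath (v j) (X j)) (j : ℕ) :
    (∀ u ∈ (G.stageFrom (↑W)ᶜ v X j).1, u ∈ W → ∃ a ∈ (G.stageFrom (↑W)ᶜ v X j).2, G.tail a = u) ∧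
    (∀ a ∈ (G.stageFrom (↑W)ᶜ v X j).2, ∀ b ∈ (G.stageFrom (↑W)ᶜ v X j).2,
      G.tail a = G.tail b → a = b) ∧
    ∀ u ∈ (G.stageFrom (↑W)ᶜ v X j).1,
      ∃ w ∉ W, Relation.ReflTransGen (G.Step (G.stageFrom (↑W)ᶜ v X j).2) u w := by
  induction j with
  | zero =>
    exact ⟨fun u hu huW => absurd huW hu, fun a ha => absurd ha (Set.notMem_empty a),
      fun u hu => ⟨u, hu, .refl⟩⟩
  | succ j ih =>
    obtain ⟨ih1, ih2, ih3⟩ := ih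
    have hp := (hX j).isPath
    obtain ⟨t, ht⟩ := (hX j).exists_notMem W
    obtain ⟨n, hn⟩ := G.exists_hitTime_eq (x := v j) (e := X j)
      (B := (G.stageFrom (↑W)ᶜ v X j).1) ⟨t, stageFrom_mono (Nat.zero_le j) ht⟩
    have hnA := (G.hitTime_eq_coe_iff.1 hn).1
    have hmono : ∀ {A A' : Set E}, A ⊆ A' → ∀ {u w}, Relation.ReflTransGen (G.Step A) u w →
        Relation.ReflTransGen (G.Step A') u w := fun hA _ _ h =>
      Relation.ReflTransGen.mono (fun _ _ ⟨a, ha, h⟩ => ⟨a, hA ha, h⟩) _ _ h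
    have hdisj : ∀ a ∈ (G.stageFrom (↑W)ᶜ v X j).2, ∀ b ∈ G.loopErasureEdges (v j) (X j)
        (G.hitTime (v j) (X j) (G.stageFrom (↑W)ᶜ v X j).1), G.tail a ≠ G.tail b :=
      fun a ha b hb hab => tail_notMem_stageFrom hp hb
        (hab ▸ tail_mem_of_mem_stageFrom (fun j => (hX j).isPath) ha)
    refine ⟨?_, ?_, ?_⟩
    · intro u hu huW
      by_cases huA : u ∈ (G.stageFrom (↑W)ᶜ v X j).1
      · obtain ⟨a, ha, hau⟩ := ih1 u huA huW
        exact ⟨a, .inl ha, hau⟩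
      · have hu' := hu.resolve_left huA
        rw [hn] at hu'
        obtain ⟨a, ha, hau⟩ := G.exists_loopErasureEdge hp hu' (fun h => huA (h ▸ hnA))
        exact ⟨a, .inr (by rw [hn]; exact ha), hau⟩
    · rintro a (ha | ha) b (hb | hb) hab
      · exact ih2 a ha b hb hab
      · exact absurd hab (hdisj a ha b hb)
      · exact absurd hab.symm (hdisj b hb a ha)
      · exact G.loopErasureEdges_unique hp ha hb hab
    · rintro u (hu | hu)
      · obtain ⟨w, hw, h⟩ := ih3 u hu
        exact ⟨w, hw, hmono Set.subset_union_left h⟩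
      · obtain ⟨w, hw, h⟩ := ih3 _ hnA
        rw [hn] at hu
        refine ⟨w, hw, (hmono ?_ (G.loopErasureVertices_reaches_end hp hu)).trans
          (hmono Set.subset_union_left h)⟩
        rw [← hn]
        exact Set.subset_union_right

variable {v : ℕ ≃ V}

lemma outputFrom_compl_eq {W : Finset V} (hX : ∀ j, G.IsTransientPath (v j) (X j)) {J : ℕ}
    (hJ : ∀ u ∈ W, v.symm u < J) :
    G.outputFrom (↑W)ᶜ v X = (G.stageFrom (↑W)ᶜ v X J).2 := by
  refine Set.Subset.antisymm (fun a ha => ?_) (Set.subset_iUnion_of_subset J subset_rfl)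
  have hp := fun j => (hX j).isPath
  obtain ⟨i, hi⟩ := Set.mem_iUnion.1 ha
  have haW : G.tail a ∈ W := by simpa using tail_notMem_of_mem_stageFrom hp hi
  exact stageFrom_edges_mono (Nat.succ_le_of_lt (hJ _ haW))
    ((mem_outputFrom_iff hp (v.apply_symm_apply _).symm).1 ha)

lemma isWiredArborescence_outputFrom {W : Finset V} (hX : ∀ j, G.IsTransientPath (v j) (X j)) :
    G.IsWiredArborescence W (G.outputFrom (↑W)ᶜ v X) := by
  obtain ⟨J, hJ⟩ : ∃ J, ∀ u ∈ W, v.symm u < J :=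
    ⟨W.sup (fun u => v.symm u) + 1, fun u hu =>
      Nat.lt_succ_of_le (Finset.le_sup (f := fun u => v.symm u) hu)⟩
  rw [outputFrom_compl_eq hX hJ]
  have hp := fun j => (hX j).isPath
  have hall : ∀ u, u ∈ (G.stageFrom (↑W)ᶜ v X J).1 := by
    intro u
    by_cases hu : u ∈ W
    · have := mem_stageFrom_succ (G := G) (B := (↑W)ᶜ) (v := v) (X := X) (v.symm u)
      rw [v.apply_symm_apply] at this
      exact stageFrom_mono (Nat.succ_le_of_lt (hJ u hu)) this
    · exact stageFrom_mono (Nat.zero_le J) (show u ∈ ((↑W)ᶜ : Set V) from hu)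
  obtain ⟨h1, h2, h3⟩ := stageFrom_arborescence (W := W) hX J
  exact ⟨fun a ha => by simpa using tail_notMem_of_mem_stageFrom hp ha,
    fun u hu => h1 u (hall u) hu, h2, fun u => h3 u (hall u)⟩

end StagePaths

/-! ### Wilson's algorithm on the wired digraph samples a uniform arborescence -/

section FiniteWilson

lemma eq_uniformOn_of_measure_singleton {Ω : Type*} [MeasurableSpace Ω]
    [MeasurableSingletonClass Ω] {μ : Measure Ω} [IsProbabilityMeasure μ] {s : Set Ω}
    (hs : s.Finite) (hμ : ∀ᵐ ω ∂μ, ω ∈ s) {c : ENNReal} (hc : ∀ ω ∈ s, μ {ω} = c) :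
    μ = uniformOn s := by
  classical
  lift s to Finset Ω using hs
  have hcard : ∀ t : Finset Ω, t ⊆ s → μ t = t.card * c := by
    intro t ht
    rw [← sum_measure_singleton, Finset.sum_congr rfl fun ω hω => hc ω (ht hω), Finset.sum_const,
      nsmul_eq_mul]
  have h1 : s.card * c = 1 := by
    rw [← hcard s subset_rfl]
    exact (mem_ae_iff_prob_eq_one s.measurableSet).1 hμ
  ext t ht
  have hst : (s : Set Ω) ∩ t = (s.filter (· ∈ t) : Finset Ω) := by ext ω; simp
  have h2 : μ t = μ ((s : Set Ω) ∩ t) := by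
    refine measure_congr ?_
    filter_upwards [hμ] with ω hω
    exact propext ⟨fun h => ⟨hω, h⟩, fun h => h.2⟩
  rw [h2, ← uniformOn_inter_self s.finite_toSet, hst, uniformOn_apply_finset,
    hcard _ (Finset.filter_subset _ _), Finset.inter_eq_right.2 (Finset.filter_subset _ _),
    ENNReal.div_eq_inv_mul, mul_comm]
  congr 1
  exact ENNReal.eq_inv_of_mul_eq_one_left (by rw [mul_comm]; exact h1)

variable {V E : Type*} [MeasurableSpace E] [DiscreteMeasurableSpace E] {G : MultiDigraph V E}
  {hloc : G.LocallyFinite} {hout : G.NoSinks}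

lemma isProbabilityMeasure_walksLaw (v : ℕ → V) :
    IsProbabilityMeasure (G.walksLaw hloc hout v) := by
  have := fun j => G.isProbabilityMeasure_walkLaw hloc hout (v j)
  unfold walksLaw
  infer_instance

variable [Countable E]

lemma ae_forall_isTransientPath (htrans : G.Transient hloc hout) (v : ℕ → V) :
    ∀ᵐ X ∂(G.walksLaw hloc hout v), ∀ j, G.IsTransientPath (v j) (X j) := by
  have := fun j => G.isProbabilityMeasure_walkLaw hloc hout (v j)
  refine ae_all_iff.2 fun j => ?_
  exact (measurePreserving_eval_infinitePi
    (fun j => G.walkLaw hloc hout (v j)) j).quasiMeasurePreserving.ae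
    (ae_isTransientPath htrans (v j))

variable [Countable V]

/-- The probability that Wilson's algorithm run for finitely many stages produces a subset of a
given arborescence is a product of one-walk probabilities, since on this event the vertex set of
each stage is deterministic. The determinants telescope. -/
lemma det_mul_walksLaw_stageFrom [DecidableEq V] (htrans : G.Transient hloc hout) {W : Finset V}
    {T : Set E} (hT : G.IsWiredArborescence W T) (v : ℕ → V) (j : ℕ) :
    ∃ S ⊆ W, (∀ i < j, v i ∉ S) ∧ ∃ B : ℕ → Set (ℕ → E), (∀ i, MeasurableSet (B i)) ∧
      (∀ X, (∀ j, G.IsTransientPath (v j) (X j)) →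
        ((G.stageFrom (↑W)ᶜ v X j).2 ⊆ T ↔ ∀ i < j, X i ∈ B i) ∧
        ((G.stageFrom (↑W)ᶜ v X j).2 ⊆ T → (G.stageFrom (↑W)ᶜ v X j).1 = (↑S)ᶜ)) ∧
      (G.killedMatrix hloc W W).det *
          ∏ i ∈ Finset.range j, (G.walkLaw hloc hout (v i)).real (B i) =
        (∏ u ∈ W \ S, ((G.outFinset hloc u).card : ℝ)⁻¹) * (G.killedMatrix hloc W S).det := by
  have hf : ∀ u, ∃ a, u ∈ W → a ∈ T ∧ G.tail a = u := by
    intro u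
    by_cases hu : u ∈ W
    · obtain ⟨a, ha, hau⟩ := hT.exists_out u hu
      exact ⟨a, fun _ => ⟨ha, hau⟩⟩
    · exact ⟨(hout u).some, fun h => absurd h hu⟩
  -- `f u` is the edge of `T` out of `u ∈ W`; its values outside `W` are irrelevant.
  choose f hf using hf
  have hfT : ∀ a ∈ T, G.tail a ∈ W → a = f (G.tail a) := fun a ha haW =>
    hT.out_unique _ ha _ (hf _ haW).1 (hf _ haW).2.symm
  induction j with
  | zero =>
    refine ⟨W, subset_rfl, by simp, fun _ => Set.univ, fun _ => .univ, fun X _ => ?_, by simp⟩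
    exact ⟨by simp [stageFrom], fun _ => rfl⟩
  | succ j ih =>
    obtain ⟨S, hSW, hvS, B, hBm, hB, hdet⟩ := ih
    obtain ⟨P, hPS, hvP, hP, hPdet⟩ := exists_det_mul_walkLaw_loopErasureEvent htrans hf hfT
      hT.acyclic S hSW (v j)
    refine ⟨S \ P, Finset.sdiff_subset.trans hSW, ?_,
      Function.update B j (G.loopErasureEvent T S (v j)), ?_, fun X hX => ?_, ?_⟩
    · intro i hi hmem
      rw [Finset.mem_sdiff] at hmem
      rcases Nat.lt_succ_iff_lt_or_eq.1 hi with h | rfl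
      · exact hvS i h hmem.1
      · exact hmem.2 (hvP hmem.1)
    · intro i
      rcases eq_or_ne i j with rfl | h
      · rw [Function.update_self]; exact G.measurableSet_loopErasureEvent T S (v i)
      · rw [Function.update_of_ne h]; exact hBm i
    · obtain ⟨h1, h2⟩ := hB X hX
      have hiff : (G.stageFrom (↑W)ᶜ v X (j + 1)).2 ⊆ T ↔
          (G.stageFrom (↑W)ᶜ v X j).2 ⊆ T ∧ X j ∈ G.loopErasureEvent T S (v j) := by
        rw [stageFrom, Set.union_subset_iff]
        refine and_congr_right fun h => ?_
        rw [h2 h]; rfl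
      constructor
      · rw [hiff, h1, Nat.forall_lt_succ_right, Function.update_self]
        refine and_congr_left' (forall₂_congr fun i hi => ?_)
        rw [Function.update_of_ne hi.ne]
      · intro h
        obtain ⟨h3, h4⟩ := hiff.1 h
        have h5 := hP _ (hX j) h4
        rw [stageFrom, h2 h3]
        ext u
        by_cases hu : u ∈ S
        · simp [h5 u hu, hu]
        · simp [hu]
    · rw [Finset.prod_range_succ, Function.update_self, Finset.prod_congr rfl (g := fun i =>
        (G.walkLaw hloc hout (v i)).real (B i)), ← mul_assoc, hdet, mul_assoc, hPdet, ← mul_assoc]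
      · congr 1
        have hset : W \ (S \ P) = (W \ S) ∪ P := by
          ext u
          have := @hPS u
          have := @hSW u
          simp only [Finset.mem_sdiff, Finset.mem_union]
          tauto
        rw [hset, Finset.prod_union]
        exact Finset.disjoint_left.2 fun u hu huP => (Finset.mem_sdiff.1 hu).2 (hPS huP)
      · intro i hi
        rw [Function.update_of_ne (Finset.mem_range.1 hi).ne]

/-- All arborescences have the same probability to be the output of Wilson's algorithm. -/
lemma walksLaw_outputFrom_eq (htrans : G.Transient hloc hout) {W : Finset V} (v : ℕ ≃ V) :
    ∃ c : ENNReal, ∀ T, G.IsWiredArborescence W T →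
      G.walksLaw hloc hout v {X | G.outputFrom (↑W)ᶜ v X = T} = c := by
  classical
  have := fun j => G.isProbabilityMeasure_walkLaw hloc hout (v j)
  obtain ⟨J, hJ⟩ : ∃ J, ∀ u ∈ W, v.symm u < J :=
    ⟨W.sup (fun u => v.symm u) + 1, fun u hu =>
      Nat.lt_succ_of_le (Finset.le_sup (f := fun u => v.symm u) hu)⟩
  refine ⟨ENNReal.ofReal ((∏ u ∈ W, ((G.outFinset hloc u).card : ℝ)⁻¹) /
    (G.killedMatrix hloc W W).det), fun T hT => ?_⟩
  obtain ⟨S, hSW, hvS, B, hBm, hB, hdet⟩ := det_mul_walksLaw_stageFrom htrans hT v J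
  have hS : S = ∅ := Finset.eq_empty_of_forall_notMem fun u hu => by
    have := hvS _ (hJ u (hSW hu))
    rw [v.apply_symm_apply] at this
    exact this hu
  subst hS
  rw [killedMatrix_empty, Matrix.det_one, mul_one, Finset.sdiff_empty] at hdet
  have hpos : 0 < ∏ u ∈ W, ((G.outFinset hloc u).card : ℝ)⁻¹ :=
    Finset.prod_pos fun u _ => inv_pos.2 <| Nat.cast_pos.2 <| Finset.card_pos.2 <| by
      obtain ⟨a, ha⟩ := hout u
      exact ⟨a, (G.mem_outFinset hloc).2 ha⟩
  -- The determinant does not vanish since its product with a probability is positive.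
  have hne : (G.killedMatrix hloc W W).det ≠ 0 := fun h => by
    rw [h, zero_mul] at hdet
    exact hpos.ne hdet
  have hae : {X | G.outputFrom (↑W)ᶜ v X = T} =ᵐ[G.walksLaw hloc hout v]
      Set.pi (Finset.range J) B := by
    filter_upwards [ae_forall_isTransientPath htrans v] with X hX
    have hA := isWiredArborescence_outputFrom (v := v) (W := W) hX
    have h1 : G.outputFrom (↑W)ᶜ v X = T ↔ G.outputFrom (↑W)ᶜ v X ⊆ T :=
      ⟨fun h => h.subset, fun h => hA.eq_of_subset hT h⟩
    have h2 := (hB X hX).1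
    rw [← outputFrom_compl_eq hX hJ, ← h1] at h2
    refine propext (h2.trans (show _ ↔ X ∈ Set.pi (Finset.range J) B from ?_))
    simp
  rw [measure_congr hae]
  change Measure.infinitePi (fun j => G.walkLaw hloc hout (v j)) _ = _
  rw [Measure.infinitePi_pi (fun j => G.walkLaw hloc hout (v j)) (fun i _ => hBm i), ← hdet,
    mul_div_cancel_left₀ _ hne, ENNReal.ofReal_prod_of_nonneg fun _ _ => measureReal_nonneg]
  exact Finset.prod_congr rfl fun i _ => (ofReal_measureReal (by finiteness)).symm

/-- Wilson's algorithm: the output on the wired digraph `G_W^*` has the law of the uniform spanning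
in-arborescence. -/
lemma map_config_outputFrom (htrans : G.Transient hloc hout) (W : Finset V) (v : ℕ ≃ V) :
    (G.walksLaw hloc hout v).map (fun X => config (G.outputFrom (↑W)ᶜ v X)) = G.wiredUA W := by
  have := G.isProbabilityMeasure_walksLaw (hloc := hloc) (hout := hout) v
  have hm := G.measurable_config_outputFrom (↑W)ᶜ v
  have := Measure.isProbabilityMeasure_map (μ := G.walksLaw hloc hout v) hm.aemeasurable
  obtain ⟨c, hc⟩ := walksLaw_outputFrom_eq htrans (W := W) v
  rw [wiredUA_eq]
  refine eq_uniformOn_of_measure_singleton ((finite_wiredArborescence hloc W).image _) (c := c)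
    ?_ ?_
  · refine (ae_map_iff hm.aemeasurable
      ((finite_wiredArborescence hloc W).image _).measurableSet).2 ?_
    filter_upwards [ae_forall_isTransientPath htrans v] with X hX
    exact ⟨_, isWiredArborescence_outputFrom hX, rfl⟩
  · rintro _ ⟨T, hT, rfl⟩
    rw [Measure.map_apply hm (measurableSet_singleton _), ← hc T hT]
    congr 1
    ext X
    exact config_injective.eq_iff

end FiniteWilson

/-! ### Passage to the limit -/

section Limit

variable {V E ι : Type*} {l : Filter ι} {N : ι → ℕ∞} {γ : ℕ → V}

lemma eventually_isLastVisit_iff (hN : ∀ T : ℕ, ∀ᶠ i in l, (T : ℕ∞) ≤ N i)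
    (hγ : ∀ u, {t | γ t = u}.Finite) (s t : ℕ) :
    ∀ᶠ i in l, IsLastVisit γ (N i) s t ↔ IsLastVisit γ ⊤ s t := by
  obtain ⟨τ, hτ⟩ := (hγ (γ s)).bddAbove
  filter_upwards [hN τ] with i hi
  have : {r : ℕ | s ≤ r ∧ (r : ℕ∞) ≤ N i ∧ γ r = γ s} =
      {r : ℕ | s ≤ r ∧ (r : ℕ∞) ≤ ⊤ ∧ γ r = γ s} := by
    ext r
    simp only [Set.mem_ofPred_eq, le_top, true_and]
    refine and_congr_right fun _ => ⟨fun h => h.2, fun h => ⟨?_, h⟩⟩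
    exact le_trans (by exact_mod_cast hτ h) hi
  rw [IsLastVisit, IsLastVisit, this]

/-- The loop-erasure of a transient path is the local limit of the loop-erasures of its initial
pieces. -/
lemma eventually_isLoopErasureTime_iff (hN : ∀ T : ℕ, ∀ᶠ i in l, (T : ℕ∞) ≤ N i)
    (hγ : ∀ u, {t | γ t = u}.Finite) (s : ℕ) :
    ∀ᶠ i in l, IsLoopErasureTime γ (N i) s ↔ IsLoopErasureTime γ ⊤ s := by
  induction s using Nat.strong_induction_on with
  | _ s ih =>
    cases s with
    | zero => simp [IsLoopErasureTime.zero]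
    | succ t =>
      have h1 : ∀ᶠ i in l, ∀ s : Fin (t + 1),
          IsLoopErasureTime γ (N i) s ↔ IsLoopErasureTime γ ⊤ s :=
        eventually_all.2 fun s => ih s s.2
      have h2 : ∀ᶠ i in l, ∀ s : Fin (t + 1), IsLastVisit γ (N i) s t ↔ IsLastVisit γ ⊤ s t :=
        eventually_all.2 fun s => eventually_isLastVisit_iff hN hγ s t
      filter_upwards [h1, h2, hN (t + 1)] with i h1 h2 h3
      have h4 : (t : ℕ∞) < N i := lt_of_lt_of_le (by exact_mod_cast Nat.lt_succ_self t) h3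
      simp only [isLoopErasureTime_succ_iff, h1, h2, h4, ENat.natCast_lt_top]

variable {G : MultiDigraph V E} {x : V} {e : ℕ → E}

lemma mem_loopErasureEdges_iff {N : ℕ∞} {a : E} : a ∈ G.loopErasureEdges x e N ↔
    ∃ t, IsLoopErasureTime (G.vertexAt x e) N (t + 1) ∧ e t = a := by
  constructor
  · rintro ⟨s, t, hs, ht, hlt, h⟩
    exact ⟨t, hs.next ht hlt, h⟩
  · rintro ⟨t, h, rfl⟩
    obtain ⟨s, hs, ht, hlt⟩ := isLoopErasureTime_succ_iff.1 h
    exact ⟨s, t, hs, ht, hlt, rfl⟩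

/-- Convergence of the hitting times of the vertex sets `A i` to that of `A`, when the former
converge pointwise to the latter. -/
lemma eventually_hitTime {A : ι → Set V} {B : Set V} (hA : ∀ u, ∀ᶠ i in l, u ∈ A i ↔ u ∈ B) :
    (∀ᶠ i in l, G.hitTime x e (A i) = G.hitTime x e B) ∨
      G.hitTime x e B = ⊤ ∧ ∀ T : ℕ, ∀ᶠ i in l, (T : ℕ∞) ≤ G.hitTime x e (A i) := by
  have h : ∀ T : ℕ, ∀ᶠ i in l, ∀ t ≤ T, G.vertexAt x e t ∈ A i ↔ G.vertexAt x e t ∈ B := fun T =>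
    (eventually_all_finite (Set.finite_Iic T)).2 fun t _ => hA _
  by_cases hB : G.hitTime x e B = ⊤
  · refine .inr ⟨hB, fun T => ?_⟩
    filter_upwards [h T] with i hi
    refine G.le_hitTime_iff.2 fun t ht => ?_
    rw [hi t ht.le]
    exact G.le_hitTime_iff.1 (hB ▸ le_top : (T : ℕ∞) ≤ G.hitTime x e B) t ht
  · left
    obtain ⟨n, hn⟩ := ENat.ne_top_iff_exists.1 hB
    rw [← hn]
    obtain ⟨h1, h2⟩ := G.hitTime_eq_coe_iff.1 hn.symm
    filter_upwards [h n] with i hi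
    exact G.hitTime_eq_coe_iff.2 ⟨(hi n le_rfl).2 h1, fun t ht => (hi t ht.le).not.2 (h2 t ht)⟩

/-- The loop-erasures of a transient path stopped on `A i` converge locally to its loop-erasure when
stopped on the pointwise limit `B` of the sets `A i`, whether or not the path ever hits `B`. -/
lemma eventually_mem_loopErasure {A : ι → Set V} {B : Set V} (he : G.IsTransientPath x e)
    (hA : ∀ u, ∀ᶠ i in l, u ∈ A i ↔ u ∈ B) :
    (∀ u, ∀ᶠ i in l, u ∈ G.loopErasureVertices x e (G.hitTime x e (A i)) ↔
      u ∈ G.loopErasureVertices x e (G.hitTime x e B)) ∧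
    ∀ a, ∀ᶠ i in l, a ∈ G.loopErasureEdges x e (G.hitTime x e (A i)) ↔
      a ∈ G.loopErasureEdges x e (G.hitTime x e B) := by
  rcases eventually_hitTime (G := G) (x := x) (e := e) hA with h | ⟨hB, h⟩
  · exact ⟨fun u => h.mono fun i hi => by rw [hi], fun a => h.mono fun i hi => by rw [hi]⟩
  · have hs := eventually_isLoopErasureTime_iff h he.finite_visits
    rw [hB]
    constructor
    · intro u
      filter_upwards [(eventually_all_finite (he.finite_visits u)).2 fun s _ => hs s] with i hi
      exact exists_congr fun s => and_congr_left fun hsu => hi s hsu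
    · intro a
      have hfin : {t | e t = a}.Finite :=
        ((he.finite_visits (G.tail a)).subset fun t ht => by
          rw [Set.mem_ofPred_eq, ← he.isPath t, show e t = a from ht])
      filter_upwards [(eventually_all_finite hfin).2 fun t _ => hs (t + 1)] with i hi
      simp only [mem_loopErasureEdges_iff]
      exact exists_congr fun t => and_congr_left fun hta => hi t hta

lemma eventually_mem_stageFrom {v : ℕ → V} {X : ℕ → ℕ → E} {B : ι → Set V}
    (hX : ∀ j, G.IsTransientPath (v j) (X j)) (hB : ∀ u, ∀ᶠ i in l, u ∉ B i) (j : ℕ) :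
    (∀ u, ∀ᶠ i in l, u ∈ (G.stageFrom (B i) v X j).1 ↔ u ∈ (G.stageFrom ∅ v X j).1) ∧
      ∀ a, ∀ᶠ i in l, a ∈ (G.stageFrom (B i) v X j).2 ↔ a ∈ (G.stageFrom ∅ v X j).2 := by
  induction j with
  | zero =>
    refine ⟨fun u => ?_, fun a => .of_forall fun i => Iff.rfl⟩
    filter_upwards [hB u] with i hi
    exact iff_of_false hi (Set.notMem_empty u)
  | succ j ih =>
    obtain ⟨h1, h2⟩ := eventually_mem_loopErasure (hX j) ih.1
    constructor
    · intro u
      filter_upwards [ih.1 u, h1 u] with i hi hi'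
      exact or_congr hi hi'
    · intro a
      filter_upwards [ih.2 a, h2 a] with i hi hi'
      exact or_congr hi hi'

lemma eventually_mem_outputFrom {v : ℕ ≃ V} {X : ℕ → ℕ → E} {W : ℕ → Finset V}
    (hW : IsExhaustion W) (hX : ∀ j, G.IsTransientPath (v j) (X j)) (a : E) :
    ∀ᶠ n in atTop, a ∈ G.outputFrom (↑(W n))ᶜ v X ↔ a ∈ G.wilsonOutput v X := by
  have hB : ∀ u, ∀ᶠ n in atTop, u ∉ ((↑(W n))ᶜ : Set V) := fun u => by
    obtain ⟨n, hn⟩ := hW.exists_mem u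
    filter_upwards [eventually_ge_atTop n] with m hm
    simpa using hW.monotone hm hn
  have hp := fun j => (hX j).isPath
  have ha : G.tail a = v (v.symm (G.tail a)) := (v.apply_symm_apply _).symm
  filter_upwards [(eventually_mem_stageFrom hX hB (v.symm (G.tail a) + 1)).2 a] with n hn
  rw [← outputFrom_empty, mem_outputFrom_iff hp ha, mem_outputFrom_iff hp ha, hn]

/-- A pointwise limit of arborescences of `G_{W_n}^*` is an arboretum: the conditions involve
finitely many edges at a time. -/
lemma isSpanningInArboretum_of_eventually (hloc : G.LocallyFinite) {W : ℕ → Finset V}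
    (hW : IsExhaustion W) {F : ℕ → Set E} {A : Set E}
    (hF : ∀ n, G.IsWiredArborescence (W n) (F n))
    (hlim : ∀ a, ∀ᶠ n in atTop, a ∈ F n ↔ a ∈ A) : G.IsSpanningInArboretum A where
  existsUnique_out u := by
    obtain ⟨m, hm⟩ := hW.exists_mem u
    obtain ⟨n, hn, hmn⟩ := (((eventually_all_finite (hloc u).2).2 fun a _ => hlim a).and
      (eventually_ge_atTop m)).exists
    obtain ⟨a, ha, hau⟩ := (hF n).exists_out u (hW.monotone hmn hm)
    refine ⟨a, ⟨(hn a hau).1 ha, hau⟩, fun b ⟨hb, hbu⟩ => ?_⟩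
    exact (hF n).out_unique b ((hn b hbu).2 hb) a ha (hbu.trans hau.symm)
  acyclic u hu := by
    have hstep : ∀ {w z}, G.Step A w z → ∀ᶠ n in atTop, G.Step (F n) w z := by
      rintro w z ⟨a, ha, haw, haz⟩
      exact (hlim a).mono fun n hn => ⟨a, hn.2 ha, haw, haz⟩
    have hcyc : ∀ {w}, Relation.TransGen (G.Step A) u w →
        ∀ᶠ n in atTop, Relation.TransGen (G.Step (F n)) u w := by
      intro w hw
      induction hw with
      | single h => exact (hstep h).mono fun n hn => .single hn
      | tail _ h ih => exact (ih.and (hstep h)).mono fun n hn => hn.1.tail hn.2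
    obtain ⟨n, hn⟩ := (hcyc hu).exists
    exact (hF n).acyclic u hn

lemma tendsto_config {F : ι → Set E} {A : Set E} (h : ∀ a, ∀ᶠ i in l, a ∈ F i ↔ a ∈ A) :
    Tendsto (fun i => config (F i)) l (𝓝 (config A)) := by
  refine tendsto_pi_nhds.2 fun a => tendsto_const_nhds.congr' ?_
  filter_upwards [h a] with i hi
  simp [config, hi]

/-- Almost sure convergence implies convergence of the laws. -/
lemma tendsto_map_of_ae_tendsto {Ω S : Type*} [MeasurableSpace Ω] [TopologicalSpace S]
    [MeasurableSpace S] [OpensMeasurableSpace S] {P : Measure Ω} [IsProbabilityMeasure P]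
    {f : ℕ → Ω → S} {g : Ω → S} (hf : ∀ n, Measurable (f n)) (hg : Measurable g)
    (h : ∀ᵐ ω ∂P, Tendsto (fun n => f n ω) atTop (𝓝 (g ω))) :
    Tendsto (β := ProbabilityMeasure S)
      (fun n => ⟨P.map (f n), Measure.isProbabilityMeasure_map (hf n).aemeasurable⟩) atTop
      (𝓝 ⟨P.map g, Measure.isProbabilityMeasure_map hg.aemeasurable⟩) := by
  refine ProbabilityMeasure.tendsto_iff_forall_integral_tendsto.2 fun φ => ?_
  have hint : ∀ {k : Ω → S}, Measurable k → ∫ s, φ s ∂(P.map k) = ∫ ω, φ (k ω) ∂P := fun hk =>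
    integral_map hk.aemeasurable
      φ.continuous.measurable.aestronglyMeasurable
  simp only [ProbabilityMeasure.coe_mk, hint (hf _), hint hg]
  refine tendsto_integral_of_dominated_convergence (fun _ => ‖φ‖)
    (fun n => (φ.continuous.measurable.comp (hf n)).aestronglyMeasurable) (integrable_const _)
    (fun n => .of_forall fun ω => φ.norm_coe_le_norm _) ?_
  filter_upwards [h] with ω hω
  exact (φ.continuous.tendsto _).comp hω

lemma isExhaustion_image_range [DecidableEq V] (v : ℕ ≃ V) :
    IsExhaustion fun n => (Finset.range n).image v where
  monotone _ _ h := Finset.image_subset_image (Finset.range_mono h)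
  exists_mem u := ⟨v.symm u + 1, Finset.mem_image.2 ⟨v.symm u, by simp, by simp⟩⟩

end Limit

/-! ### The wired uniform spanning arboretum -/

section Main

variable {V E : Type*} [MeasurableSpace E] [DiscreteMeasurableSpace E] {G : MultiDigraph V E}
  {hloc : G.LocallyFinite} {hout : G.NoSinks}

lemma ae_isSpanningInArboretum_wilsonOutput [Countable E] (htrans : G.Transient hloc hout)
    {W : ℕ → Finset V} (hW : IsExhaustion W) (v : ℕ ≃ V) :
    ∀ᵐ X ∂(G.walksLaw hloc hout v), G.IsSpanningInArboretum (G.wilsonOutput v X) := by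
  filter_upwards [ae_forall_isTransientPath htrans v] with X hX
  exact isSpanningInArboretum_of_eventually hloc hW
    (fun n => isWiredArborescence_outputFrom (v := v) hX) fun a => eventually_mem_outputFrom hW hX a

variable [Countable V]

lemma measurable_config_wilsonOutput (v : ℕ → V) :
    Measurable fun X => config (G.wilsonOutput v X) := by
  simpa only [outputFrom_empty] using G.measurable_config_outputFrom ∅ v

variable [Countable E]

variable (G hloc hout) in
/-- The law of the output of Wilson's algorithm rooted at infinity. -/
noncomputable def wilsonLaw (v : ℕ → V) : ProbabilityMeasure (E → Bool) :=
  ⟨(G.walksLaw hloc hout v).map fun X => config (G.wilsonOutput v X),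
    have := G.isProbabilityMeasure_walksLaw (hloc := hloc) (hout := hout) v
    Measure.isProbabilityMeasure_map (measurable_config_wilsonOutput v).aemeasurable⟩

lemma isProbabilityMeasure_wiredUA (htrans : G.Transient hloc hout) (W : Finset V) (v : ℕ ≃ V) :
    IsProbabilityMeasure (G.wiredUA W) := by
  have := G.isProbabilityMeasure_walksLaw (hloc := hloc) (hout := hout) v
  rw [← map_config_outputFrom htrans W v]
  exact Measure.isProbabilityMeasure_map (G.measurable_config_outputFrom _ v).aemeasurable

/-- Run with the same walks, Wilson's algorithm on `G_{W_n}^*` converges almost surely to Wilson's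
algorithm rooted at infinity. -/
lemma tendsto_wiredUA (htrans : G.Transient hloc hout) {W : ℕ → Finset V} (hW : IsExhaustion W)
    (v : ℕ ≃ V) (hp : ∀ n, IsProbabilityMeasure (G.wiredUA (W n))) :
    Tendsto (β := ProbabilityMeasure (E → Bool)) (fun n => ⟨G.wiredUA (W n), hp n⟩) atTop
      (𝓝 (G.wilsonLaw hloc hout v)) := by
  have := G.isProbabilityMeasure_walksLaw (hloc := hloc) (hout := hout) v
  have h := tendsto_map_of_ae_tendsto (P := G.walksLaw hloc hout v)
    (fun n => G.measurable_config_outputFrom (↑(W n))ᶜ v) (measurable_config_wilsonOutput v) (by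
      filter_upwards [ae_forall_isTransientPath htrans v] with X hX
      exact tendsto_config fun a => eventually_mem_outputFrom hW hX a)
  simp only [map_config_outputFrom htrans] at h
  exact h

end Main

end MultiDigraph

theorem mainTheorem7 {V E : Type*} [Countable V] [Infinite V] [Countable E]
    [MeasurableSpace E] [DiscreteMeasurableSpace E] (G : MultiDigraph V E)
    (hconn : G.Connected) (hloc : G.LocallyFinite) (hout : G.NoSinks)
    (htrans : G.Transient hloc hout) :
    ∃ μ : ProbabilityMeasure (E → Bool),
      (∀ W : ℕ → Finset V, MultiDigraph.IsExhaustion W →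
        ∃ hW : ∀ n, IsProbabilityMeasure (G.wiredUA (W n)),
          Tendsto (β := ProbabilityMeasure (E → Bool))
            (fun n => ⟨G.wiredUA (W n), hW n⟩) atTop (𝓝 μ)) ∧
      ∀ v : ℕ ≃ V,
        HasLaw (fun X => MultiDigraph.config (G.wilsonOutput v X)) (μ : Measure (E → Bool))
          (G.walksLaw hloc hout v) ∧
        ∀ᵐ X ∂(G.walksLaw hloc hout v), G.IsSpanningInArboretum (G.wilsonOutput v X) := by
  classical
  obtain ⟨v₀⟩ : Nonempty (ℕ ≃ V) := nonempty_equiv_of_countable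
  have hW₀ := MultiDigraph.isExhaustion_image_range v₀
  have hp := fun W => MultiDigraph.isProbabilityMeasure_wiredUA htrans W v₀
  refine ⟨G.wilsonLaw hloc hout v₀, fun W hW =>
    ⟨fun n => hp (W n), MultiDigraph.tendsto_wiredUA htrans hW v₀ _⟩, fun v => ⟨⟨?_, ?_⟩,
      MultiDigraph.ae_isSpanningInArboretum_wilsonOutput htrans hW₀ v⟩⟩
  · exact (MultiDigraph.measurable_config_wilsonOutput v).aemeasurable
  · -- The law does not depend on the enumeration, being the limit along a fixed exhaustion.
    exact congrArg Subtype.val (tendsto_nhds_unique (X := ProbabilityMeasure (E → Bool))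
      (MultiDigraph.tendsto_wiredUA htrans hW₀ v fun n => hp _)
      (MultiDigraph.tendsto_wiredUA htrans hW₀ v₀ fun n => hp _))
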